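/- A multiset over a set $X$ is a function $A\colon X\to\mathbb N$; its cardinality is $|A|=\sum_{x}A(x)$. A \emph{net} $N=(S,T,F,M_0)$ consists of disjoint sets $S$ (places) and $T$ (transitions), a flow function $F\colon (S\times T)\cup(T\times S)\to\mathbb N$ and an initial marking $M_0\colon S\to\mathbb N$, such that for each $t\in T$ the set $\{s\mid F(s,t)>0\}$ is finite and non-empty and $\{s\mid F(t,s)>0\}$ is finite. Put ${}^\bullet x(y)=F(y,x)$ and $x^\bullet(y)=F(x,y)$, extended additively to multisets. Let $F^+$ be the transitive closure of $\{(x,y)\mid F(x,y)>0\}$. For markings $M,M'\colon S\to\mathbb N$ and a finite non-empty multiset $G$ of transitions, $M\xrightarrow{G}M'$ iff ${}^\bullet G\le M$ and $M'=(M-{}^\bullet G)+G^\bullet$; $G$ is \emph{enabled} at $M$ if such an $M'$ exists. A marking is \emph{reachable} if it is obtained from $M_0$ by a finite (possibly empty) sequence of firings of single transitions. $N$ is \emph{conflict-free} if there are no reachable $M$ and finite non-empty multiset $G$ of transitions such that $G$ is not enabled at $M$ but, for each $t\in G$, the restriction $G\upharpoonright\{t\}$ ($t$ with its multiplicity in $G$)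 is. $N$ is a \emph{structural conflict net} if, whenever for (possibly equal) $t,u\in T$ the multiset $\{t,u\}$ is enabled at a reachable marking, ${}^\bullet t\cap{}^\bullet u=\emptyset$. A \emph{GR-process} of $N$ is a pair $P=(\mathcal N,\pi)$ of a net $\mathcal N=(\mathcal S,\mathcal T,\mathcal F,\mathcal M_0)$ and a map $\pi\colon\mathcal S\cup\mathcal T\to S\cup T$ with $\pi(\mathcal S)\subseteq S$, $\pi(\mathcal T)\subseteq T$, such that: $|{}^\bullet s|\le 1$ and $|s^\bullet|\le1$ for all $s\in\mathcal S$; $\mathcal M_0(s)=1$ if ${}^\bullet s=\emptyset$ and $\mathcal M_0(s)=0$ otherwise; $\mathcal F^+$ is irreflexive; $\{t\in\mathcal T\mid (t,u)\in\mathcal F^+\}$ is finite for each $u\in\mathcal T$; and, extending $\pi$ to multisets by $\pi(A)(y)=\sum_{\pi(x)=y}A(x)$, $\pi(\mathcal M_0)=M_0$ and $\pi({}^\bullet t)={}^\bullet\pi(t)$, $\pi(t^\bullet)=\pi(t)^\bullet$ for all $t\in\mathcal T$. It is \emph{finite} if $\mathcal T$ is finite. $P\cong P'$ means that there is an isomorphism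 $\phi$ of the underlying nets with $\pi=\pi'\circ\phi$. $P'$ is a \emph{prefix} of $P$, and $P$ an \emph{extension} of $P'$, written $P'\le P$, if $\mathcal S'\subseteq\mathcal S$, $\mathcal T'\subseteq\mathcal T$, $\mathcal M_0'=\mathcal M_0$ (in particular $\mathcal M_0$ vanishes outside $\mathcal S'$), and $\mathcal F'$, $\pi'$ are the restrictions of $\mathcal F$, $\pi$. A GR-process is \emph{maximal} if it has no proper extension. For places $p,q\in\mathcal S$ with $\pi(p)=\pi(q)$ and $(p,q),(q,p)\notin\mathcal F^+$, $\mathrm{swap}(P,p,q)$ is obtained from $P$ by exchanging the arcs leaving $p$ and $q$. Write $P\equiv_1 Q$ if $\mathrm{swap}(P,p,q)\cong Q$ for some such $p,q$, and let $\equiv_1^*$ be the reflexive and transitive closure of $\equiv_1$. \emph{Swapping equivalence} $P\equiv_1^\infty Q$ means: for each finite prefix $P''\le P$ there are $Q'\equiv_1^* Q$ and $Q''\le Q'$ with $P''\cong Q''$, and for each finite prefix $Q''\le Q$ there are $P'\equiv_1^*P$ and $P''\le P'$ with $P''\cong Q''$. \textbf{Theorem.} Let $N$ be a conflict-free structural conflict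 net. Then $N$ has a unique maximal GR-process up to $\equiv_1^\infty$: a maximal GR-process of $N$ exists, and any two maximal GR-processes $P,Q$ of $N$ satisfy $P\equiv_1^\infty Q$. -/

import Mathlib

universe u

/-! ### Nets

A multiset over `X` is a function `X → ℕ`; a finite multiset of transitions is a `Multiset`. -/

/-- The cardinality `∑ x, A x` (possibly infinite) of a multiset `A : X → ℕ`, as the number of
its element occurrences. -/
noncomputable def msCard {X : Type u} (A : X → ℕ) : ℕ∞ := ENat.card (Σ x : X, Fin (A x))

/-- The image `y ↦ ∑_{x, f x = y} A x` of a multiset `A` under `f` (possibly infinite). -/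
noncomputable def msImage {X Y : Type u} (f : X → Y) (A : X → ℕ) (y : Y) : ℕ∞ :=
  msCard (fun x : {x : X // f x = y} => A x.1)

/-- A net (place/transition system with arc weights, of finite synchronisation, in which each
transition has at least one preplace). The flow relation `F` is split into its two components:
`pre s t = F (s, t)` and `post t s = F (t, s)`. -/
structure PTNet : Type (u + 1) where
  Place : Type u
  Trans : Type u
  pre : Place → Trans → ℕ
  post : Trans → Place → ℕ
  init : Place → ℕ
  pre_finite : ∀ t, {s | 0 < pre s t}.Finite
  pre_nonempty : ∀ t, {s | 0 < pre s t}.Nonempty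
  post_finite : ∀ t, {s | 0 < post t s}.Finite

namespace PTNet

variable (N : PTNet.{u})

/-- A marking of a net. -/
abbrev Marking : Type u := N.Place → ℕ

/-- The multiset `•G` of places, for a finite multiset `G` of transitions. -/
def preset (G : Multiset N.Trans) : N.Marking := fun s => (G.map fun t => N.pre s t).sum

/-- The multiset `G•` of places, for a finite multiset `G` of transitions. -/
def postset (G : Multiset N.Trans) : N.Marking := fun s => (G.map fun t => N.post t s).sum

/-- `G` is a step from `M` to `M'`. Subtraction of markings is pointwise and truncated. -/
def Step (M : N.Marking) (G : Multiset N.Trans) (M' : N.Marking) : Prop :=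
  G ≠ 0 ∧ N.preset G ≤ M ∧ M' = (M - N.preset G) + N.postset G

/-- `M` enables the step `G`. -/
def Enabled (M : N.Marking) (G : Multiset N.Trans) : Prop := ∃ M', N.Step M G M'

/-- `M` is reached from the initial marking by some finite firing sequence of single
transitions. -/
def Reachable (M : N.Marking) : Prop :=
  Relation.ReflTransGen (fun M₁ M₂ => ∃ t : N.Trans, N.Step M₁ {t} M₂) N.init M

open Classical in
/-- The finite non-empty multiset `G` is in (semantic) conflict in `M`. Here
`G.filter (· = t)` is the restriction of `G` to `{t}`, with its multiplicity. -/
def InConflict (M : N.Marking) (G : Multiset N.Trans) : Prop :=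
  G ≠ 0 ∧ ¬ N.Enabled M G ∧ ∀ t ∈ G, N.Enabled M (G.filter (· = t))

/-- `N` is (semantically) conflict-free. -/
def ConflictFree : Prop :=
  ∀ M, N.Reachable M → ∀ G : Multiset N.Trans, ¬ N.InConflict M G

/-- `N` is a structural conflict net: transitions `t`, `u` (possibly equal) that occur together
in one step enabled at a reachable marking have no common preplace. -/
def IsStructuralConflictNet : Prop :=
  ∀ M, N.Reachable M → ∀ t u : N.Trans, N.Enabled M {t, u} →
    ∀ s, min (N.pre s t) (N.pre s u) = 0

/-- `(x, y)` is an arc of the net, i.e. `F (x, y) > 0`. -/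
def Arc : N.Place ⊕ N.Trans → N.Place ⊕ N.Trans → Prop
  | .inl s, .inr t => 0 < N.pre s t
  | .inr t, .inl s => 0 < N.post t s
  | _, _ => False

/-- The transitive closure `F⁺` of the flow relation. -/
def Causes : N.Place ⊕ N.Trans → N.Place ⊕ N.Trans → Prop := Relation.TransGen N.Arc

open Classical in
/-- The net with the arcs leaving the places `p` and `q` swapped. -/
noncomputable def swapOut (p q : N.Place) : PTNet.{u} where
  Place := N.Place
  Trans := N.Trans
  pre s t := N.pre (Equiv.swap p q s) t
  post := N.post
  init := N.init
  pre_finite t :=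
    Set.Finite.preimage (f := Equiv.swap p q) (Equiv.injective _).injOn (N.pre_finite t)
  pre_nonempty t := by
    obtain ⟨s, hs⟩ := N.pre_nonempty t
    exact ⟨Equiv.swap p q s, by simpa using hs⟩
  post_finite := N.post_finite

end PTNet

/-! ### Processes -/

/-- A net together with a sort-preserving map to the net `N`. -/
structure MappedNet (N : PTNet.{u}) : Type (u + 1) where
  net : PTNet.{u}
  onPlace : net.Place → N.Place
  onTrans : net.Trans → N.Trans

namespace MappedNet

variable {N : PTNet.{u}}

open Classical in
/-- The conditions under which a net with a map to `N` is a (GR-)process of `N`. -/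
structure IsProcess (P : MappedNet N) : Prop where
  card_pre_le : ∀ s, msCard (fun t => P.net.post t s) ≤ 1
  card_post_le : ∀ s, msCard (fun t => P.net.pre s t) ≤ 1
  init_eq : ∀ s, P.net.init s = if ∀ t, P.net.post t s = 0 then 1 else 0
  acyclic : ∀ x, ¬ P.net.Causes x x
  finite_past : ∀ v : P.net.Trans, {t : P.net.Trans | P.net.Causes (.inr t) (.inr v)}.Finite
  map_init : ∀ s : N.Place, msImage P.onPlace P.net.init s = N.init s
  map_pre : ∀ (t : P.net.Trans) (s : N.Place),
    msImage P.onPlace (fun x => P.net.pre x t) s = N.pre s (P.onTrans t)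
  map_post : ∀ (t : P.net.Trans) (s : N.Place),
    msImage P.onPlace (fun x => P.net.post t x) s = N.post (P.onTrans t) s

/-- `swap(P, p, q)`, as a net with a map to `N`. -/
noncomputable def swap (P : MappedNet N) (p q : P.net.Place) : MappedNet N where
  net := P.net.swapOut p q
  onPlace := P.onPlace
  onTrans := P.onTrans

/-- Isomorphism of nets, respecting the maps to `N`. -/
def Iso (P Q : MappedNet N) : Prop :=
  ∃ (f : P.net.Place ≃ Q.net.Place) (g : P.net.Trans ≃ Q.net.Trans),
    (∀ s, Q.net.init (f s) = P.net.init s) ∧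
    (∀ s t, Q.net.pre (f s) (g t) = P.net.pre s t) ∧
    (∀ t s, Q.net.post (g t) (f s) = P.net.post t s) ∧
    (∀ s, Q.onPlace (f s) = P.onPlace s) ∧
    (∀ t, Q.onTrans (g t) = P.onTrans t)

/-- An identification of `P` with a prefix of `Q`: the injections `f`, `g` play the role of the
inclusions of places and of transitions. The initial marking of `P` is (extensionally) the one
of `Q`, and the flow relation and the map to `N` of `P` are the restrictions of those of `Q`. -/
structure PrefixEmb (P Q : MappedNet N) : Type u where
  f : P.net.Place → Q.net.Place
  g : P.net.Trans → Q.net.Trans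
  f_inj : Function.Injective f
  g_inj : Function.Injective g
  init_eq : ∀ s, Q.net.init (f s) = P.net.init s
  init_range : ∀ s, s ∉ Set.range f → Q.net.init s = 0
  pre_eq : ∀ s t, Q.net.pre (f s) (g t) = P.net.pre s t
  post_eq : ∀ t s, Q.net.post (g t) (f s) = P.net.post t s
  onPlace_eq : ∀ s, Q.onPlace (f s) = P.onPlace s
  onTrans_eq : ∀ t, Q.onTrans (g t) = P.onTrans t

end MappedNet

/-- A (GR-)process of the net `N`. -/
structure GRProcess (N : PTNet.{u}) : Type (u + 1) extends MappedNet N where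
  isProcess : toMappedNet.IsProcess

namespace GRProcess

variable {N : PTNet.{u}}

/-- `P` is finite: it has finitely many transitions. -/
def IsFinite (P : GRProcess N) : Prop := Finite P.net.Trans

/-- `P ≅ Q`. -/
def Iso (P Q : GRProcess N) : Prop := P.toMappedNet.Iso Q.toMappedNet

/-- `P ≤ Q`: up to renaming of places and transitions, `P` is a prefix of `Q`. -/
def IsPrefix (P Q : GRProcess N) : Prop := Nonempty (P.toMappedNet.PrefixEmb Q.toMappedNet)

/-- `P` is maximal: it has no proper extension, i.e. in every way of regarding `P` as a prefix
of a process `Q`, all places and transitions of `Q` already belong to `P`. -/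
def IsMaximal (P : GRProcess N) : Prop :=
  ∀ (Q : GRProcess N) (e : P.toMappedNet.PrefixEmb Q.toMappedNet),
    Function.Surjective e.f ∧ Function.Surjective e.g

/-- `P ≡₁ Q`: one step swapping equivalence. -/
def SwapEquivOne (P Q : GRProcess N) : Prop :=
  ∃ p q : P.net.Place,
    ¬ P.net.Causes (.inl p) (.inl q) ∧ ¬ P.net.Causes (.inl q) (.inl p) ∧
    P.onPlace p = P.onPlace q ∧ (P.toMappedNet.swap p q).Iso Q.toMappedNet

/-- `P ≡₁* Q`: the reflexive and transitive closure of `≡₁`. -/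
def SwapEquivStar : GRProcess N → GRProcess N → Prop := Relation.ReflTransGen SwapEquivOne

/-- `P ≡₁^∞ Q`: swapping equivalence. -/
def SwapEquiv (P Q : GRProcess N) : Prop :=
  (∀ P'' : GRProcess N, P''.IsFinite → P''.IsPrefix P →
    ∃ Q' Q'' : GRProcess N, Q'.SwapEquivStar Q ∧ Q''.IsPrefix Q' ∧ P''.Iso Q'') ∧
  (∀ Q'' : GRProcess N, Q''.IsFinite → Q''.IsPrefix Q →
    ∃ P' P'' : GRProcess N, P'.SwapEquivStar P ∧ P''.IsPrefix P' ∧ P''.Iso Q'')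

end GRProcess

/-! ### Cardinalities of multisets -/

/-! A process is maximal exactly when it is stuck (`IsStuck`): no set of unconsumed places carries
the labels of a preset of `N`. If there is such a set, a transition can be added
(`IsMaximal.isStuck`); conversely, an earliest new transition of a proper extension would consume
such a set (`isMaximal_of_isStuck`). Existence is Zorn's lemma for sets of firings in an unfolding
whose tokens are terms recording their own history.

Uniqueness reduces to `exists_isPrefix`: every finite process `P` embeds as a prefix into some `Q'`
with `Q' ≡₁* Q`, for `Q` stuck. Fire the transitions of `P` one by one, keeping an isomorphism
between the fired part `D` of `P` and a part `D'` of a swapped `Q`. The preset of the next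
transition `t` of `P` corresponds to a set `A` of unconsumed places of `Q`. In a conflict-free
structural conflict net, differently labelled transitions enabled together have disjoint presets, so
`A` stays untouched until a transition with the label of `t` fires; since `Q` is stuck, such a
transition `v` does occur (`exists_occurrence`).

The preset of `v` may differ from `A`, but both lie in one cut and carry the same labels. Swapping
equally labelled places of that cut turns one into the other without changing the part `D'`
(`exists_partIso_insert_aux`); then `v` can fire directly after `D'` and extends the isomorphism. -/

theorem msCard_le_one_iff {X : Type u} {A : X → ℕ} :
    msCard A ≤ 1 ↔ (∀ x, A x ≤ 1) ∧ ∀ x y, 0 < A x → 0 < A y → x = y := by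
  rw [msCard, ENat.card_le_one_iff_subsingleton]
  constructor
  · intro h
    refine ⟨fun x => ?_, fun x y hx hy => ?_⟩
    · by_contra! hx
      have := h.elim (⟨x, ⟨0, by omega⟩⟩ : Σ x : X, Fin (A x)) ⟨x, ⟨1, hx⟩⟩
      simp at this
    · exact congrArg Sigma.fst (h.elim (⟨x, ⟨0, hx⟩⟩ : Σ x : X, Fin (A x)) ⟨y, ⟨0, hy⟩⟩)
  · rintro ⟨h1, h2⟩
    refine ⟨?_⟩
    rintro ⟨x, i⟩ ⟨y, j⟩
    obtain rfl := h2 x y (by have := i.2; omega) (by have := j.2; omega)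
    have := h1 x
    congr 1
    ext
    omega

/-- Arc weights and initial marking of a process are at most one, so its multisets are sets; this
turns the axioms on `π` into counts of places. -/
theorem msImage_eq_encard {X Y : Type u} (f : X → Y) {A : X → ℕ} (hA : ∀ x, A x ≤ 1) (y : Y) :
    msImage f A y = {x | 0 < A x ∧ f x = y}.encard := by
  rw [msImage, msCard, Set.encard]
  refine ENat.card_congr
    { toFun := fun z => ⟨z.1.1, Nat.pos_of_ne_zero fun h => (h ▸ z.2).elim0, z.1.2⟩
      invFun := fun z => ⟨⟨z.1, z.2.2⟩, ⟨0, z.2.1⟩⟩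
      left_inv := ?_
      right_inv := fun z => rfl }
  rintro ⟨⟨x, hx⟩, i⟩
  have := hA x
  refine Sigma.ext rfl (heq_of_eq (Fin.ext ?_))
  change A x ≤ 1 at this
  have h' : i.1 < A x := i.2
  change 0 = i.1
  omega

/-! ### Label-preserving bijections between sets -/

/-- The relation `R` is a bijection from `s` to `t` that respects the labels `l` and `m`. -/
structure LabelBij {α β γ : Type*} (l : α → γ) (m : β → γ) (s : Set α) (t : Set β)
    (R : α → β → Prop) : Prop where
  left_mem : ∀ {x y}, R x y → x ∈ s
  right_mem : ∀ {x y}, R x y → y ∈ t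
  left_total : ∀ {x}, x ∈ s → ∃ y, R x y
  right_total : ∀ {y}, y ∈ t → ∃ x, R x y
  left_unique : ∀ {x x' y}, R x y → R x' y → x = x'
  right_unique : ∀ {x y y'}, R x y → R x y' → y = y'
  label : ∀ {x y}, R x y → m y = l x

namespace LabelBij

variable {α β γ : Type*} {l : α → γ} {m : β → γ} {s s' : Set α} {t t' : Set β}
  {R R' : α → β → Prop}

theorem union (h : LabelBij l m s t R) (h' : LabelBij l m s' t' R') (hs : Disjoint s s')
    (ht : Disjoint t t') : LabelBij l m (s ∪ s') (t ∪ t') (fun x y => R x y ∨ R' x y) where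
  left_mem := Or.imp h.left_mem h'.left_mem
  right_mem := Or.imp h.right_mem h'.right_mem
  left_total := by
    rintro x (hx | hx)
    · exact (h.left_total hx).imp fun _ => Or.inl
    · exact (h'.left_total hx).imp fun _ => Or.inr
  right_total := by
    rintro x (hx | hx)
    · exact (h.right_total hx).imp fun _ => Or.inl
    · exact (h'.right_total hx).imp fun _ => Or.inr
  left_unique := by
    rintro x x' y (h1 | h1) (h2 | h2)
    · exact h.left_unique h1 h2
    · exact (Set.disjoint_left.1 ht (h.right_mem h1) (h'.right_mem h2)).elim
    · exact (Set.disjoint_left.1 ht (h.right_mem h2) (h'.right_mem h1)).elim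
    · exact h'.left_unique h1 h2
  right_unique := by
    rintro x y y' (h1 | h1) (h2 | h2)
    · exact h.right_unique h1 h2
    · exact (Set.disjoint_left.1 hs (h.left_mem h1) (h'.left_mem h2)).elim
    · exact (Set.disjoint_left.1 hs (h.left_mem h2) (h'.left_mem h1)).elim
    · exact h'.right_unique h1 h2
  label := by
    rintro x y (h1 | h1)
    · exact h.label h1
    · exact h'.label h1

theorem singleton {a : α} {b : β} (hab : m b = l a) :
    LabelBij l m {a} {b} (fun x y => x = a ∧ y = b) where
  left_mem h := h.1
  right_mem h := h.2
  left_total h := ⟨b, h, rfl⟩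
  right_total h := ⟨a, rfl, h⟩
  left_unique h h' := h.1.trans h'.1.symm
  right_unique h h' := h.2.trans h'.2.symm
  label h := by rw [h.1, h.2, hab]

theorem encard_image (h : LabelBij l m s t R) {u : Set α} (hu : u ⊆ s) (c : γ) :
    {y | (∃ x ∈ u, R x y) ∧ m y = c}.encard = {x | x ∈ u ∧ l x = c}.encard := by
  symm
  choose f hf using fun x : u => h.left_total (hu x.2)
  have hinj : Set.InjOn f {x | l x = c} := by
    rintro ⟨x, hx⟩ - ⟨x', hx'⟩ - hxx
    have h1 := hf ⟨x, hx⟩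
    have h2 := hf ⟨x', hx'⟩
    rw [hxx] at h1
    exact Subtype.ext (h.left_unique h1 h2)
  rw [show {x | x ∈ u ∧ l x = c} = Subtype.val '' {x : u | l x = c} by ext; simp [and_comm],
    Subtype.val_injective.encard_image, ← hinj.encard_image]
  congr 1
  ext y
  constructor
  · rintro ⟨x, rfl, rfl⟩
    exact ⟨⟨x, x.2, hf x⟩, h.label (hf x)⟩
  · rintro ⟨⟨x, hx, hxy⟩, rfl⟩
    exact ⟨⟨x, hx⟩, (h.label hxy).symm, h.right_unique (hf ⟨x, hx⟩) hxy⟩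

/-- The label fibres are matched one at a time. They must be finite, as `encard` does not
distinguish infinite cardinals. -/
theorem exists_of_encard_eq (hfin : ∀ c, {x | x ∈ s ∧ l x = c}.Finite)
    (hcard : ∀ c, {x | x ∈ s ∧ l x = c}.encard = {y | y ∈ t ∧ m y = c}.encard) :
    ∃ R, LabelBij l m s t R := by
  have key : ∀ c, Nonempty ({x | x ∈ s ∧ l x = c} ≃ {y | y ∈ t ∧ m y = c}) := by
    intro c
    have h1 := hfin c
    have h2 : {y | y ∈ t ∧ m y = c}.Finite := by
      rw [← Set.encard_lt_top_iff, ← hcard c]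
      exact h1.encard_lt_top
    have := h1.to_subtype
    have := h2.to_subtype
    exact Finite.card_eq.1 (congrArg ENat.toNat (hcard c))
  have e := fun c => (key c).some
  refine ⟨fun x y => ∃ c, ∃ z : {x | x ∈ s ∧ l x = c}, (z : α) = x ∧ (e c z : β) = y,
    ?_, ?_, ?_, ?_, ?_, ?_, ?_⟩
  · rintro x y ⟨c, z, rfl, rfl⟩
    exact z.2.1
  · rintro x y ⟨c, z, rfl, rfl⟩
    exact (e c z).2.1
  · exact fun {x} hx => ⟨_, l x, ⟨x, hx, rfl⟩, rfl, rfl⟩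
  · exact fun {y} hy => ⟨_, m y, (e (m y)).symm ⟨y, hy, rfl⟩, rfl, by simp⟩
  · rintro x x' y ⟨c, z, rfl, rfl⟩ ⟨c', z', rfl, hz⟩
    obtain rfl : c' = c := by rw [← (e c z).2.2, ← hz, (e c' z').2.2]
    rw [(e c').injective (Subtype.ext hz)]
  · rintro x y y' ⟨c, z, rfl, rfl⟩ ⟨c', z', hz, rfl⟩
    obtain rfl : c' = c := by rw [← z.2.2, ← hz, z'.2.2]
    rw [Subtype.ext hz]
  · rintro x y ⟨c, z, rfl, rfl⟩
    rw [(e c z).2.2, z.2.2]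

end LabelBij

/-! ### Occurrence nets and their configurations -/

namespace PTNet

variable (N : PTNet.{u})

/-- Some place produced by `t` is consumed by `v`. -/
def Prec (t v : N.Trans) : Prop := ∃ s, 0 < N.post t s ∧ 0 < N.pre s v

/-- The places that are initially marked or produced by a transition in `D`. -/
def produced (D : Set N.Trans) : Set N.Place := {s | 0 < N.init s ∨ ∃ t ∈ D, 0 < N.post t s}

/-- The places that are produced and not consumed when all transitions in `D` have fired. -/
def cut (D : Set N.Trans) : Set N.Place := {s | s ∈ N.produced D ∧ ∀ t ∈ D, N.pre s t = 0}

/-- The transition `t` can fire next when all transitions in `D` have fired. -/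
def CanAdd (D : Set N.Trans) (t : N.Trans) : Prop := t ∉ D ∧ ∀ s, 0 < N.pre s t → s ∈ N.cut D

/-- The set `D'` of transitions is obtained from `D` by firing transitions one by one. -/
def ExtendsTo : Set N.Trans → Set N.Trans → Prop :=
  Relation.ReflTransGen fun D D' => ∃ t, N.CanAdd D t ∧ D' = insert t D

/-- `D` is the set of transitions of some firing sequence. -/
def Config (D : Set N.Trans) : Prop := N.ExtendsTo ∅ D

open Classical in
/-- A causal net: conflict-free and acyclic, with arcs of weight one, all transitions of which
have a finite past. -/
structure IsCausalNet : Prop where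
  pre_le_one : ∀ s t, N.pre s t ≤ 1
  post_le_one : ∀ t s, N.post t s ≤ 1
  consumer_unique : ∀ {s t v}, 0 < N.pre s t → 0 < N.pre s v → t = v
  producer_unique : ∀ {s t v}, 0 < N.post t s → 0 < N.post v s → t = v
  init_eq : ∀ s, N.init s = if ∀ t, N.post t s = 0 then 1 else 0
  wf : WellFounded N.Prec

variable {N} {D D' D₁ : Set N.Trans} {t v : N.Trans} {s : N.Place}

theorem produced_mono (h : D ⊆ D') : N.produced D ⊆ N.produced D' := by
  rintro s (hs | ⟨t, ht, hs⟩)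
  · exact Or.inl hs
  · exact Or.inr ⟨t, h ht, hs⟩

theorem produced_insert : N.produced (insert t D) = N.produced D ∪ {s | 0 < N.post t s} := by
  ext s
  simp [produced, or_left_comm, or_comm]

theorem mem_cut_of_subset (h : D ⊆ D') (hs : s ∈ N.produced D) (hs' : s ∈ N.cut D') :
    s ∈ N.cut D :=
  ⟨hs, fun t ht => hs'.2 t (h ht)⟩

namespace ExtendsTo

theorem subset (h : N.ExtendsTo D D') : D ⊆ D' := by
  induction h with
  | refl => exact subset_rfl
  | tail _ h ih =>
    obtain ⟨t, -, rfl⟩ := h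
    exact ih.trans (Set.subset_insert _ _)

theorem finite (h : N.ExtendsTo D D') (hD : D.Finite) : D'.Finite := by
  induction h with
  | refl => exact hD
  | tail _ h ih =>
    obtain ⟨t, -, rfl⟩ := h
    exact ih.insert t

end ExtendsTo

namespace Config

theorem finite (h : N.Config D) : D.Finite := ExtendsTo.finite h Set.finite_empty

theorem trans (h : N.Config D) (h' : N.ExtendsTo D D') : N.Config D' :=
  Relation.ReflTransGen.trans h h'

theorem insert (h : N.Config D) (ht : N.CanAdd D t) :
    N.Config (Insert.insert t D) :=
  Relation.ReflTransGen.tail h ⟨t, ht, rfl⟩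

@[elab_as_elim]
theorem induct {motive : ∀ D, N.Config D → Prop} (empty : motive ∅ .refl)
    (insert : ∀ D t (hD : N.Config D) (ht : N.CanAdd D t), motive D hD →
      motive (Insert.insert t D) (hD.insert ht))
    {D : Set N.Trans} (h : N.Config D) : motive D h := by
  induction h with
  | refl => exact empty
  | tail h h' ih =>
    obtain ⟨t, ht, rfl⟩ := h'
    exact insert _ t h ht ih

theorem mem_produced (h : N.Config D) (ht : t ∈ D) (hs : 0 < N.pre s t) : s ∈ N.produced D := by
  induction h using induct with
  | empty => exact ht.elim
  | insert D v hD hv ih =>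
    refine produced_mono (Set.subset_insert _ _) ?_
    rcases ht with rfl | ht
    · exact (hv.2 s hs).1
    · exact ih ht

end Config

theorem CanAdd.disjoint (ht : N.CanAdd D t) : Disjoint D {t} := by
  simpa using ht.1

theorem exists_extendsTo_of_finite {V : Set N.Trans} (hV : V.Finite)
    (h : ∀ v ∈ V, ∀ D, ∃ D', N.ExtendsTo D D' ∧ v ∈ D') (D : Set N.Trans) :
    ∃ D', N.ExtendsTo D D' ∧ V ⊆ D' := by
  induction V, hV using Set.Finite.induction_on with
  | empty => exact ⟨D, .refl, Set.empty_subset _⟩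
  | @insert v V _ _ ih =>
    obtain ⟨D', h1, h2⟩ := ih fun w hw => h w (Set.mem_insert_of_mem _ hw)
    obtain ⟨D'', h3, h4⟩ := h v (Set.mem_insert _ _) D'
    exact ⟨D'', h1.trans h3, Set.insert_subset h4 (h2.trans h3.subset)⟩

namespace IsCausalNet

variable (hN : N.IsCausalNet)
include hN

theorem not_produced_of_init (h : 0 < N.init s) (t : N.Trans) : N.post t s = 0 := by
  rw [hN.init_eq] at h
  by_contra h'
  rw [if_neg fun h => h' (h t)] at h
  exact h.ne rfl

theorem init_eq_zero_iff : N.init s = 0 ↔ ∃ t, 0 < N.post t s := by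
  rw [hN.init_eq]
  simp [Nat.pos_iff_ne_zero]

theorem init_le_one : N.init s ≤ 1 := by
  rw [hN.init_eq]
  split_ifs <;> simp

theorem mem_produced_iff (h : 0 < N.post t s) : s ∈ N.produced D ↔ t ∈ D := by
  constructor
  · rintro (h' | ⟨v, hv, h'⟩)
    · exact absurd (hN.not_produced_of_init h' t) h.ne'
    · rwa [hN.producer_unique h h']
  · exact fun h' => Or.inr ⟨t, h', h⟩

theorem produced_univ : N.produced Set.univ = Set.univ := by
  refine Set.eq_univ_of_forall fun s => ?_
  by_cases h : N.init s = 0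
  · obtain ⟨t, ht⟩ := hN.init_eq_zero_iff.1 h
    exact Or.inr ⟨t, trivial, ht⟩
  · exact Or.inl (Nat.pos_of_ne_zero h)

/-- Consumers are unique, so only `t` itself could have removed one of its preplaces. -/
theorem canAdd (ht : t ∉ D) (h : ∀ v, N.Prec v t → v ∈ D) : N.CanAdd D t := by
  refine ⟨ht, fun s hs => ⟨?_, fun v hv => ?_⟩⟩
  · by_cases hi : N.init s = 0
    · obtain ⟨v, hv⟩ := hN.init_eq_zero_iff.1 hi
      exact Or.inr ⟨v, h v ⟨s, hv, hs⟩, hv⟩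
    · exact Or.inl (Nat.pos_of_ne_zero hi)
  · by_contra h0
    exact ht (hN.consumer_unique hs (Nat.pos_of_ne_zero h0) ▸ hv)

theorem finite_prec (t : N.Trans) : {v | N.Prec v t}.Finite := by
  refine ((N.pre_finite t).biUnion (t := fun s => {v | 0 < N.post v s})
    fun s _ => Set.Subsingleton.finite fun v hv w hw => hN.producer_unique hv hw).subset ?_
  rintro v ⟨s, h1, h2⟩
  exact Set.mem_biUnion (show s ∈ {s | 0 < N.pre s t} from h2) h1

/-- By well-founded induction, the finitely many direct predecessors of `t` can be fired first.
Nothing can ever disable `t`. -/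
theorem exists_extendsTo (t : N.Trans) : ∀ D, ∃ D', N.ExtendsTo D D' ∧ t ∈ D' := by
  induction t using hN.wf.induction with
  | _ t ih =>
    intro D
    obtain ⟨D', h1, h2⟩ := exists_extendsTo_of_finite (hN.finite_prec t) ih D
    by_cases ht : t ∈ D'
    · exact ⟨D', h1, ht⟩
    · exact ⟨_, h1.tail ⟨t, hN.canAdd ht h2, rfl⟩, Set.mem_insert _ _⟩

theorem exists_config_superset {V : Set N.Trans} (hV : V.Finite) : ∃ D, N.Config D ∧ V ⊆ D :=
  exists_extendsTo_of_finite hV (fun v _ => hN.exists_extendsTo v) ∅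

/-- Configurations are causally downward closed: walk back along a path, using that producers are
unique. -/
theorem mem_of_causes (h : N.Config D) (ht : t ∈ D) {x : N.Place ⊕ N.Trans}
    (hx : N.Causes x (.inr t)) : x.elim (· ∈ N.produced D) (· ∈ D) := by
  refine Relation.TransGen.head_induction_on
    (motive := fun x _ => x.elim (· ∈ N.produced D) (· ∈ D)) hx ?_ ?_
  · rintro (s | v) hv
    · exact h.mem_produced ht hv
    · exact hv.elim
  · rintro (s | v) (s' | v') h1 _ ih
    · exact h1.elim
    · exact h.mem_produced ih h1
    · exact (hN.mem_produced_iff h1).1 ih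
    · exact h1.elim

theorem finite_past (t : N.Trans) : {v | N.Causes (.inr v) (.inr t)}.Finite := by
  obtain ⟨D, hD, ht⟩ := hN.exists_config_superset (Set.finite_singleton t)
  exact hD.finite.subset fun v hv => hN.mem_of_causes hD (ht rfl) hv

theorem acyclic (x : N.Place ⊕ N.Trans) : ¬ N.Causes x x := by
  have key : ∀ t, Acc N.Arc (.inr t) := by
    intro t
    induction t using hN.wf.induction with
    | _ t ih =>
      refine ⟨_, ?_⟩
      rintro (s | v) hs
      · refine ⟨_, ?_⟩
        rintro (s' | v) hv
        · exact hv.elim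
        · exact ih v ⟨s, hv, hs⟩
      · exact hs.elim
  have hwf : WellFounded N.Arc := by
    refine ⟨?_⟩
    rintro (s | t)
    · refine ⟨_, ?_⟩
      rintro (s' | v) hv
      · exact hv.elim
      · exact key v
    · exact key t
  exact fun h => hwf.transGen.irrefl.irrefl x h

/-- A path from `p` to `q` would start with a consumer of `p` in the past of the producer of `q`,
hence in `D`. This makes any two equally labelled places of a cut legitimate candidates for a swap.
-/
theorem not_causes_of_mem_cut (h : N.Config D) {p q : N.Place} (hp : p ∈ N.cut D)
    (hq : q ∈ N.cut D) : ¬ N.Causes (.inl p) (.inl q) := by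
  intro hpq
  obtain ⟨y, hy, hyq⟩ := Relation.TransGen.tail'_iff.1 hpq
  obtain (s | t) := y
  · exact hyq.elim
  have ht : t ∈ D := (hN.mem_produced_iff hyq).1 hq.1
  obtain h' | h' := Relation.reflTransGen_iff_eq_or_transGen.1 hy
  · exact Sum.inr_ne_inl h'
  obtain ⟨z, hz, hzt⟩ := Relation.TransGen.head'_iff.1 h'
  obtain (s | v) := z
  · exact hz.elim
  have hv : v ∈ D := by
    obtain h' | h' := Relation.reflTransGen_iff_eq_or_transGen.1 hzt
    · exact Sum.inr_injective h' ▸ ht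
    · exact hN.mem_of_causes h ht h'
  exact (show 0 < N.pre p v from hz).ne' (hp.2 v hv)

theorem cut_insert (hc : N.Config D) (ht : N.CanAdd D t) :
    N.cut (insert t D) = (N.cut D \ {s | 0 < N.pre s t}) ∪ {s | 0 < N.post t s} := by
  rw [cut, produced_insert]
  ext s
  simp only [Set.mem_ofPred_eq, Set.mem_union, Set.mem_sdiff, Set.forall_mem_insert, cut, not_lt,
    Nat.le_zero]
  constructor
  · rintro ⟨h1 | h1, h2, h3⟩
    · exact Or.inl ⟨⟨h1, h3⟩, h2⟩
    · exact Or.inr h1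
  · rintro (⟨⟨h1, h3⟩, h2⟩ | h1)
    · exact ⟨Or.inl h1, h2, h3⟩
    · have hD := mt (hN.mem_produced_iff (D := D) h1).1 ht.1
      refine ⟨Or.inr h1, ?_, fun v hv => ?_⟩
      · by_contra h0
        exact hD (ht.2 s (Nat.pos_of_ne_zero h0)).1
      · by_contra h0
        exact hD (hc.mem_produced hv (Nat.pos_of_ne_zero h0))

end IsCausalNet

/-- Nets in which every transition belongs to a configuration are well-founded. -/
theorem wf_prec_of_config
    (hu : ∀ {s t v}, 0 < N.post t s → 0 < N.post v s → t = v)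
    (hi : ∀ s t, 0 < N.init s → N.post t s = 0)
    (h : ∀ t, ∃ D, N.Config D ∧ t ∈ D) : WellFounded N.Prec := by
  refine ⟨fun t => ?_⟩
  obtain ⟨D, hD, ht⟩ := h t
  induction hD using Config.induct generalizing t with
  | empty => exact ht.elim
  | insert D w hD hw ih =>
    rcases ht with rfl | ht
    · refine ⟨_, ?_⟩
      rintro v ⟨s, hv, hs⟩
      obtain h1 | ⟨v', h1, h2⟩ := (hw.2 s hs).1
      · exact absurd (hi s v h1) hv.ne'
      · exact ih v (hu hv h2 ▸ h1)
    · exact ih t ht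

/-- The number of transitions in the past is a strictly increasing rank. -/
theorem wf_prec_of_causes (h1 : ∀ x, ¬ N.Causes x x)
    (h2 : ∀ t, {v | N.Causes (.inr v) (.inr t)}.Finite) : WellFounded N.Prec := by
  refine Subrelation.wf (r := InvImage (· < ·) fun t => {v | N.Causes (.inr v) (.inr t)}.ncard)
    ?_ (InvImage.wf _ wellFounded_lt)
  rintro t v ⟨s, hs, hs'⟩
  have htv : N.Causes (.inr t) (.inr v) :=
    .tail (.single (show N.Arc (.inr t) (.inl s) from hs))
      (show N.Arc (.inl s) (.inr v) from hs')
  exact Set.ncard_lt_ncard ⟨fun w hw => Relation.TransGen.trans hw htv, fun h => h1 _ (h htv)⟩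
    (h2 v)

/-! ### Swapping places of a cut -/

open Classical in
theorem swapOut_pre (p q s : N.Place) (t : N.Trans) :
    (N.swapOut p q).pre s t = N.pre (Equiv.swap p q s) t := by
  unfold swapOut
  congr!

open Classical in
-- Once `p` and `q` have both been produced, presets and cut are permuted by the same transposition.
theorem canAdd_swapOut_iff {p q : N.Place} (hp : p ∈ N.produced D) (hq : q ∈ N.produced D) :
    (N.swapOut p q).CanAdd D t ↔ N.CanAdd D t := by
  have hpr : ∀ s, Equiv.swap p q s ∈ N.produced D ↔ s ∈ N.produced D := by
    intro s
    rw [Equiv.swap_apply_def]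
    split_ifs with h1 h2
    · simp [h1, hp, hq]
    · simp [h2, hp, hq]
    · rfl
  have hcut : ∀ s, s ∈ (N.swapOut p q).cut D ↔ Equiv.swap p q s ∈ N.cut D := fun s =>
    and_congr (hpr s).symm <| forall₂_congr fun t _ =>
      Eq.congr_left (swapOut_pre p q s t)
  refine and_congr Iff.rfl ⟨fun h s hs => ?_, fun h s hs => ?_⟩
  · have := (hcut (Equiv.swap p q s)).1 (h _ (by rw [swapOut_pre]; simpa using hs))
    simpa using this
  · exact (hcut s).2 (h _ (lt_of_lt_of_eq hs (swapOut_pre p q s t)))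

open Classical in
theorem pre_swapOut_eq {p q : N.Place} (hp : p ∈ N.cut D) (hq : q ∈ N.cut D) (ht : t ∈ D) :
    (N.swapOut p q).pre s t = N.pre s t := by
  rw [swapOut_pre, Equiv.swap_apply_def]
  split_ifs with h1 h2
  · rw [h1, hp.2 t ht, hq.2 t ht]
  · rw [h2, hp.2 t ht, hq.2 t ht]
  · rfl

theorem mem_cut_swapOut_iff {p q : N.Place} (hp : p ∈ N.cut D₁) (hq : q ∈ N.cut D₁)
    (hD : D ⊆ D₁) : s ∈ (N.swapOut p q).cut D ↔ s ∈ N.cut D :=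
  and_congr Iff.rfl <| forall₂_congr fun _ ht => by
    rw [← pre_swapOut_eq hp hq (hD ht)]

theorem Config.swapOut {p q : N.Place} (hp : p ∈ N.cut D₁) (hq : q ∈ N.cut D₁)
    (hD : N.Config D) (h : D ⊆ D₁) : (N.swapOut p q).Config D := by
  induction hD using induct with
  | empty => exact .refl
  | insert D t hD ht ih =>
    have h' := (Set.subset_insert t D).trans h
    refine (ih h').insert ⟨ht.1, fun s hs => ?_⟩
    replace hs := lt_of_lt_of_eq hs (pre_swapOut_eq hp hq (h (Set.mem_insert _ _)))
    exact (mem_cut_swapOut_iff hp hq h').2 (ht.2 s hs)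

theorem ExtendsTo.swapOut {p q : N.Place} (hp : p ∈ N.produced D) (hq : q ∈ N.produced D)
    (h : N.ExtendsTo D D') : (N.swapOut p q).ExtendsTo D D' := by
  induction h with
  | refl => exact .refl
  | tail h h' ih =>
    obtain ⟨t, ht, rfl⟩ := h'
    have := produced_mono (ExtendsTo.subset h)
    exact ih.tail ⟨t, (canAdd_swapOut_iff (this hp) (this hq)).2 ht, rfl⟩

theorem IsCausalNet.swapOut (hN : N.IsCausalNet) {p q : N.Place} (hD : N.Config D)
    (hp : p ∈ N.cut D) (hq : q ∈ N.cut D) : (N.swapOut p q).IsCausalNet where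
  pre_le_one s t := hN.pre_le_one _ t
  post_le_one := hN.post_le_one
  consumer_unique h h' := hN.consumer_unique h h'
  producer_unique h h' := hN.producer_unique h h'
  init_eq := hN.init_eq
  wf := by
    refine wf_prec_of_config (fun h h' => hN.producer_unique h h')
      (fun s t h => hN.not_produced_of_init h t) fun t => ?_
    -- Every transition occurs in a configuration of the swapped net: up to `D` the swap is
    -- invisible, and beyond `D` both places are already produced, so the same firing sequences
    -- remain possible.
    obtain ⟨D', h1, h2⟩ := hN.exists_extendsTo t D
    exact ⟨D', (hD.swapOut hp hq subset_rfl).trans (h1.swapOut hp.1 hq.1), h2⟩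

end PTNet

/-! ### Consequences of conflict-freeness for enabled transitions. -/

namespace PTNet

variable {N : PTNet.{u}}

theorem enabled_iff {M : N.Marking} {G : Multiset N.Trans} :
    N.Enabled M G ↔ G ≠ 0 ∧ N.preset G ≤ M :=
  ⟨fun ⟨_, h1, h2, _⟩ => ⟨h1, h2⟩, fun h => ⟨_, h.1, h.2, rfl⟩⟩

theorem preset_singleton (t : N.Trans) : N.preset {t} = fun s => N.pre s t := by
  funext s
  simp [preset]

theorem postset_singleton (t : N.Trans) : N.postset {t} = N.post t := by
  funext s
  simp [postset]

theorem enabled_singleton_iff {M : N.Marking} {t : N.Trans} :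
    N.Enabled M {t} ↔ ∀ s, N.pre s t ≤ M s := by
  rw [enabled_iff, preset_singleton]
  exact and_iff_right (Multiset.singleton_ne_zero t)

/-- In a conflict-free structural conflict net, different transitions that are enabled at the
same reachable marking have no common preplace. -/
theorem min_pre_eq_zero (hS : N.IsStructuralConflictNet) (hC : N.ConflictFree) {M : N.Marking}
    (hM : N.Reachable M) {t v : N.Trans} (htv : t ≠ v) (ht : N.Enabled M {t})
    (hv : N.Enabled M {v}) (s : N.Place) : min (N.pre s t) (N.pre s v) = 0 := by
  classical
  refine hS M hM t v ?_ s
  -- If `{t, v}` were not enabled it would be a conflict, since its restrictions `{t}` and `{v}` are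
  -- enabled.
  by_contra h
  refine hC M hM {t, v} ⟨by simp, h, ?_⟩
  intro w hw
  rw [Multiset.insert_eq_cons, Multiset.mem_cons, Multiset.mem_singleton] at hw
  rcases hw with rfl | rfl
  · convert ht
    simp [Multiset.insert_eq_cons, Multiset.filter_singleton, htv.symm]
  · convert hv
    simp [Multiset.insert_eq_cons, Multiset.filter_singleton, htv]

end PTNet

/-! ### Labelled causal nets, stuckness, and the markings of `N` they reach. -/

namespace MappedNet

variable {N : PTNet.{u}} (P : MappedNet N)

/-- The multiset of labels of the set `A` of places is the preset of `a`. -/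
def IsPresetOf (A : Set P.net.Place) (a : N.Trans) : Prop :=
  ∀ c, {s | s ∈ A ∧ P.onPlace s = c}.encard = N.pre c a

/-- The labelling respects initial markings, presets and postsets, in terms of sets of places. -/
structure Folds : Prop where
  encard_init : ∀ c, {s | 0 < P.net.init s ∧ P.onPlace s = c}.encard = N.init c
  encard_pre : ∀ t, P.IsPresetOf {s | 0 < P.net.pre s t} (P.onTrans t)
  encard_post : ∀ t c, {s | 0 < P.net.post t s ∧ P.onPlace s = c}.encard = N.post (P.onTrans t) c

/-- No transition can be added to `P`: each set of places that could serve as the preset of a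
new transition contains a place that is already consumed. -/
def IsStuck : Prop := ∀ a A, P.IsPresetOf A a → ∃ s ∈ A, ∃ t, 0 < P.net.pre s t

/-- The marking reached when all transitions in `D` have fired. -/
noncomputable def marking (D : Set P.net.Trans) : N.Marking :=
  fun c => {s | s ∈ P.net.cut D ∧ P.onPlace s = c}.ncard

variable {P}

theorem IsProcess.isCausalNet (h : IsProcess P) : P.net.IsCausalNet where
  pre_le_one s := (msCard_le_one_iff.1 (h.card_post_le s)).1
  post_le_one t s := (msCard_le_one_iff.1 (h.card_pre_le s)).1 t
  consumer_unique := (msCard_le_one_iff.1 (h.card_post_le _)).2 _ _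
  producer_unique := (msCard_le_one_iff.1 (h.card_pre_le _)).2 _ _
  init_eq := h.init_eq
  wf := PTNet.wf_prec_of_causes h.acyclic h.finite_past

theorem IsProcess.folds (h : IsProcess P) : P.Folds where
  encard_init c := by
    rw [← h.map_init, msImage_eq_encard _ fun _ => h.isCausalNet.init_le_one]
  encard_pre t c := by
    rw [← h.map_pre, msImage_eq_encard _ fun s => h.isCausalNet.pre_le_one s t]
    rfl
  encard_post t c := by
    rw [← h.map_post, msImage_eq_encard _ fun s => h.isCausalNet.post_le_one t s]

theorem isProcess_of_isCausalNet (h : P.net.IsCausalNet) (h' : P.Folds) : IsProcess P where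
  card_pre_le s := msCard_le_one_iff.2 ⟨fun t => h.post_le_one t s, fun _ _ => h.producer_unique⟩
  card_post_le s := msCard_le_one_iff.2 ⟨fun t => h.pre_le_one s t, fun _ _ => h.consumer_unique⟩
  init_eq := h.init_eq
  acyclic := h.acyclic
  finite_past := h.finite_past
  map_init c := by
    rw [← h'.encard_init, msImage_eq_encard _ fun _ => h.init_le_one]
  map_pre t c := by
    rw [← h'.encard_pre, msImage_eq_encard _ fun s => h.pre_le_one s t]
    rfl
  map_post t c := by
    rw [← h'.encard_post, msImage_eq_encard _ fun s => h.post_le_one t s]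

variable {D D' : Set P.net.Trans} {A B : Set P.net.Place} {a : N.Trans} {c : N.Place}

theorem IsPresetOf.finite (h : P.IsPresetOf A a) (c : N.Place) :
    {s | s ∈ A ∧ P.onPlace s = c}.Finite := by
  rw [← Set.encard_lt_top_iff, h c]
  exact ENat.natCast_lt_top _

theorem IsPresetOf.ncard (h : P.IsPresetOf A a) (c : N.Place) :
    {s | s ∈ A ∧ P.onPlace s = c}.ncard = N.pre c a := by
  rw [Set.ncard, h c, ENat.toNat_natCast]

theorem IsPresetOf.finite_self (h : P.IsPresetOf A a) : A.Finite := by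
  refine ((N.pre_finite a).biUnion fun c _ => h.finite c).subset fun s hs => ?_
  refine Set.mem_biUnion (x := P.onPlace s) ?_ ⟨hs, rfl⟩
  refine Nat.pos_of_ne_zero fun h0 => ?_
  have := h (P.onPlace s)
  rw [h0, Nat.cast_zero, Set.encard_eq_zero] at this
  exact (this.le ⟨hs, rfl⟩ : s ∈ (∅ : Set P.net.Place))

theorem IsPresetOf.pre_pos (h : P.IsPresetOf A a) {s : P.net.Place} (hs : s ∈ A) :
    0 < N.pre (P.onPlace s) a := by
  rw [← h.ncard, Set.ncard_pos (h.finite _)]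
  exact ⟨s, hs, rfl⟩

theorem Folds.finite_init (h : P.Folds) (c : N.Place) :
    {s | 0 < P.net.init s ∧ P.onPlace s = c}.Finite := by
  rw [← Set.encard_lt_top_iff, h.encard_init c]
  exact ENat.natCast_lt_top _

theorem Folds.finite_post (h : P.Folds) (t : P.net.Trans) (c : N.Place) :
    {s | 0 < P.net.post t s ∧ P.onPlace s = c}.Finite := by
  rw [← Set.encard_lt_top_iff, h.encard_post t c]
  exact ENat.natCast_lt_top _

theorem Folds.ncard_post (h : P.Folds) (t : P.net.Trans) (c : N.Place) :
    {s | 0 < P.net.post t s ∧ P.onPlace s = c}.ncard = N.post (P.onTrans t) c := by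
  rw [Set.ncard, h.encard_post, ENat.toNat_natCast]

/-- Firing in `P` is mirrored step by step in `N`. Finiteness of the label fibres is carried along
because `marking` is defined with `ncard`. -/
theorem reachable_marking (hP : P.net.IsCausalNet) (h : P.Folds) (hD : P.net.Config D) :
    (∀ c, {s | s ∈ P.net.cut D ∧ P.onPlace s = c}.Finite) ∧ N.Reachable (P.marking D) := by
  induction hD using PTNet.Config.induct with
  | empty =>
    have : ∀ c, {s | s ∈ P.net.cut ∅ ∧ P.onPlace s = c} =
        {s | 0 < P.net.init s ∧ P.onPlace s = c} := by
      intro c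
      ext s
      simp [PTNet.cut, PTNet.produced]
    refine ⟨fun c => this c ▸ h.finite_init c, ?_⟩
    have h0 : P.marking ∅ = N.init := by
      funext c
      rw [marking, this, Set.ncard, h.encard_init, ENat.toNat_natCast]
    rw [h0]
    exact .refl
  | insert D t hD ht ih =>
    obtain ⟨hfin, hr⟩ := ih
    have hcut := hP.cut_insert hD ht
    have hf : ∀ c, {s | s ∈ P.net.cut (insert t D) ∧ P.onPlace s = c} =
        ({s | s ∈ P.net.cut D ∧ P.onPlace s = c} \ {s | 0 < P.net.pre s t ∧ P.onPlace s = c}) ∪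
          {s | 0 < P.net.post t s ∧ P.onPlace s = c} := by
      intro c
      ext s
      rw [hcut]
      simp only [Set.mem_ofPred_eq, Set.mem_union, Set.mem_sdiff]
      tauto
    have hsub : ∀ c, {s | 0 < P.net.pre s t ∧ P.onPlace s = c} ⊆
        {s | s ∈ P.net.cut D ∧ P.onPlace s = c} := fun c s hs => ⟨ht.2 s hs.1, hs.2⟩
    refine ⟨fun c => ?_, hr.tail ⟨P.onTrans t, by simp, ?_, ?_⟩⟩
    · rw [hf]
      exact ((hfin c).sdiff).union (h.finite_post t c)
    · rw [PTNet.preset_singleton]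
      intro c
      change N.pre c (P.onTrans t) ≤ _
      rw [← (h.encard_pre t).ncard]
      exact Set.ncard_le_ncard (hsub c) (hfin c)
    · rw [PTNet.preset_singleton, PTNet.postset_singleton]
      funext c
      rw [marking, hf, Set.ncard_union_eq _ (hfin c).sdiff (h.finite_post t c),
        Set.ncard_sdiff (hsub c) ((h.encard_pre t).finite c), h.ncard_post]
      · simp only [Pi.add_apply, Pi.sub_apply, ← (h.encard_pre t).ncard]
        rfl
      · refine Set.disjoint_left.2 fun s hs hs' => ?_
        exact ht.1 ((hP.mem_produced_iff hs'.1).1 hs.1.1.1)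

theorem enabled_marking (hfin : ∀ c, {s | s ∈ P.net.cut D ∧ P.onPlace s = c}.Finite)
    (hA : P.IsPresetOf A a) (h : A ⊆ P.net.cut D) : N.Enabled (P.marking D) {a} := by
  rw [PTNet.enabled_singleton_iff]
  intro c
  rw [← hA.ncard]
  exact Set.ncard_le_ncard (fun s hs => ⟨h hs.1, hs.2⟩) (hfin c)

/-- If `P` is stuck, an enabled transition of `N` occurs eventually; until then, the tokens
enabling it remain untouched. -/
theorem exists_occurrence (hS : N.IsStructuralConflictNet) (hC : N.ConflictFree)
    (hP : P.net.IsCausalNet) (h : P.Folds) (hs : P.IsStuck) (hD : P.net.Config D)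
    (hA : P.IsPresetOf A a) (hAD : A ⊆ P.net.cut D) :
    ∃ D₁ t, D ⊆ D₁ ∧ P.net.Config D₁ ∧ P.net.CanAdd D₁ t ∧ A ⊆ P.net.cut D₁ ∧
      P.onTrans t = a := by
  obtain ⟨s, hsA, v, hsv⟩ := hs a A hA
  obtain ⟨D', hDD', hv⟩ := hP.exists_extendsTo v D
  by_contra hcon
  -- As long as no transition labelled `a` fires, no token of `A` is consumed; this contradicts `v ∈
  -- D'`, which consumes `s ∈ A`.
  have key : A ⊆ P.net.cut D' := by
    clear hv
    induction hDD' with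
    | refl => exact hAD
    | @tail D₁ D₂ hDD₁ h₁ ih =>
      obtain ⟨t, ht, rfl⟩ := h₁
      have hD₁ := hD.trans hDD₁
      by_cases hta : P.onTrans t = a
      · exact absurd ⟨D₁, t, PTNet.ExtendsTo.subset hDD₁, hD₁, ht, ih, hta⟩ hcon
      obtain ⟨hfin, hr⟩ := reachable_marking hP h hD₁
      have hmin := PTNet.min_pre_eq_zero hS hC hr hta
        (enabled_marking hfin (h.encard_pre t) ht.2) (enabled_marking hfin hA ih)
      intro s hs
      rw [hP.cut_insert hD₁ ht]
      refine Or.inl ⟨ih hs, fun hst => ?_⟩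
      -- A place of `A` consumed by `t` would have a label in the presets of both `P.onTrans t` and
      -- `a`.
      have h1 := (h.encard_pre t).pre_pos hst
      have h2 := hA.pre_pos hs
      exact (lt_min h1 h2).ne' (hmin _)
  exact hsv.ne' ((key hsA).2 v hv)

end MappedNet

/-! ### Swapping in processes -/

namespace MappedNet

variable {N : PTNet.{u}} {P Q : MappedNet N}

open Classical in
theorem IsPresetOf.preimage_swap {A : Set P.net.Place} {a : N.Trans} (hA : P.IsPresetOf A a)
    {p q : P.net.Place} (hpq : P.onPlace p = P.onPlace q) :
    P.IsPresetOf (Equiv.swap p q ⁻¹' A) a := by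
  intro c
  have hl : ∀ s, P.onPlace (Equiv.swap p q s) = P.onPlace s := by
    intro s
    rw [Equiv.swap_apply_def]
    split_ifs with h1 h2
    · rw [h1, hpq]
    · rw [h2, hpq]
    · rfl
  rw [← hA c, ← Set.encard_preimage_of_bijective (Equiv.swap p q).bijective {s | s ∈ A ∧ _}]
  congr 1
  ext s
  exact and_congr Iff.rfl (Eq.congr_left (hl s).symm)

theorem Folds.swap (h : P.Folds) {p q : P.net.Place} (hpq : P.onPlace p = P.onPlace q) :
    (P.swap p q).Folds where
  encard_init := h.encard_init
  encard_pre t := by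
    classical
    intro c
    refine Eq.trans ?_ ((h.encard_pre t).preimage_swap hpq c)
    refine congrArg Set.encard (Set.ext fun s => and_congr ?_ Iff.rfl)
    exact Eq.to_iff (congrArg (0 < ·) (PTNet.swapOut_pre p q s t))
  encard_post := h.encard_post

theorem IsStuck.swap (h : P.IsStuck) {p q : P.net.Place} (hpq : P.onPlace p = P.onPlace q) :
    (P.swap p q).IsStuck := by
  classical
  intro a A hA
  obtain ⟨s, hs, t, ht⟩ := h a _ (IsPresetOf.preimage_swap (P := P) hA hpq)
  refine ⟨Equiv.swap p q s, hs, t, lt_of_lt_of_eq ht ?_⟩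
  refine (Eq.trans ?_ (PTNet.swapOut_pre p q _ t).symm)
  simp

/-- The relations `R` and `G` are an isomorphism between the parts of `P` and `Q` with the sets
`D` and `D'` of transitions. -/
structure PartIso (P Q : MappedNet N) (D : Set P.net.Trans) (D' : Set Q.net.Trans)
    (R : P.net.Place → Q.net.Place → Prop) (G : P.net.Trans → Q.net.Trans → Prop) : Prop where
  place : LabelBij P.onPlace Q.onPlace (P.net.produced D) (Q.net.produced D') R
  trans : LabelBij P.onTrans Q.onTrans D D' G
  init_eq : ∀ {x y}, R x y → Q.net.init y = P.net.init x
  pre_eq : ∀ {x y t v}, R x y → G t v → Q.net.pre y v = P.net.pre x t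
  post_eq : ∀ {x y t v}, R x y → G t v → Q.net.post v y = P.net.post t x

namespace PartIso

variable {D : Set P.net.Trans} {D' D₁ : Set Q.net.Trans} {R : P.net.Place → Q.net.Place → Prop}
  {G : P.net.Trans → Q.net.Trans → Prop} {t : P.net.Trans} {v : Q.net.Trans}

/-- No transition of `D' ⊆ D₁` consumes `p` or `q`, so the matched part does not see the swap. -/
theorem swap (h : PartIso P Q D D' R G) {p q : Q.net.Place} (hD : D' ⊆ D₁)
    (hp : p ∈ Q.net.cut D₁) (hq : q ∈ Q.net.cut D₁) : PartIso P (Q.swap p q) D D' R G where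
  place := h.place
  trans := h.trans
  init_eq := h.init_eq
  pre_eq hR hG := (PTNet.pre_swapOut_eq hp hq (hD (h.trans.right_mem hG))).trans (h.pre_eq hR hG)
  post_eq := h.post_eq

theorem insert (h : PartIso P Q D D' R G) (hP : P.net.IsCausalNet) (hP' : P.Folds)
    (hQ : Q.net.IsCausalNet) (hQ' : Q.Folds) (hD : P.net.Config D) (hD' : Q.net.Config D')
    (ht : P.net.CanAdd D t) (hv : Q.net.CanAdd D' v) (hl : Q.onTrans v = P.onTrans t)
    (hpre : ∀ {x y}, R x y → Q.net.pre y v = P.net.pre x t) :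
    ∃ R G, PartIso P Q (insert t D) (insert v D') R G := by
  -- The new places are the postsets of `t` and `v`. They may be matched by any label-preserving
  -- bijection, as nothing fired so far consumes them.
  obtain ⟨R', hR'⟩ := LabelBij.exists_of_encard_eq (l := P.onPlace) (m := Q.onPlace)
    (s := {x | 0 < P.net.post t x}) (t := {y | 0 < Q.net.post v y})
    (hP'.finite_post t) (fun c => (hP'.encard_post t c).trans
      ((hQ'.encard_post v c).trans (by rw [hl])).symm)
  have hpt : ∀ {x}, x ∈ P.net.produced D → P.net.post t x = 0 := fun {x} hx => by
    by_contra h0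
    exact ht.1 ((hP.mem_produced_iff (Nat.pos_of_ne_zero h0)).1 hx)
  have hqv : ∀ {x}, x ∈ Q.net.produced D' → Q.net.post v x = 0 := fun {x} hx => by
    by_contra h0
    exact hv.1 ((hQ.mem_produced_iff (Nat.pos_of_ne_zero h0)).1 hx)
  have hnP : ∀ {x y}, R' x y → x ∉ P.net.produced D := fun {x y} hR hx =>
    (show 0 < P.net.post t x from hR'.left_mem hR).ne' (hpt hx)
  have hnQ : ∀ {x y}, R' x y → y ∉ Q.net.produced D' := fun {x y} hR hx =>
    (show 0 < Q.net.post v y from hR'.right_mem hR).ne' (hqv hx)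
  refine ⟨fun x y => R x y ∨ R' x y, _, ?_, (Set.union_singleton ▸ Set.union_singleton ▸
    h.trans.union (.singleton hl) ht.disjoint hv.disjoint), ?_, ?_, ?_⟩
  · rw [PTNet.produced_insert, PTNet.produced_insert]
    refine h.place.union hR' (Set.disjoint_left.2 fun x hx hx' => ?_)
      (Set.disjoint_left.2 fun x hx hx' => ?_)
    · exact (show 0 < P.net.post t x from hx').ne' (hpt hx)
    · exact (show 0 < Q.net.post v x from hx').ne' (hqv hx)
  · rintro x y (hR | hR)
    · exact h.init_eq hR
    · rw [hP.init_eq_zero_iff.2 ⟨t, hR'.left_mem hR⟩, hQ.init_eq_zero_iff.2 ⟨v, hR'.right_mem hR⟩]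
  · rintro x y t' v' (hR | hR) (hG | ⟨rfl, rfl⟩)
    · exact h.pre_eq hR hG
    · exact hpre hR
    · rw [Nat.eq_zero_of_not_pos fun h0 => hnP hR (hD.mem_produced (h.trans.left_mem hG) h0),
        Nat.eq_zero_of_not_pos fun h0 => hnQ hR (hD'.mem_produced (h.trans.right_mem hG) h0)]
    · rw [Nat.eq_zero_of_not_pos fun h0 => hnP hR (ht.2 _ h0).1,
        Nat.eq_zero_of_not_pos fun h0 => hnQ hR (hv.2 _ h0).1]
  · rintro x y t' v' (hR | hR) (hG | ⟨rfl, rfl⟩)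
    · exact h.post_eq hR hG
    · rw [hpt (h.place.left_mem hR), hqv (h.place.right_mem hR)]
    · have h1 : P.net.post t' x = 0 := Nat.eq_zero_of_not_pos fun h0 =>
        ht.1 (hP.producer_unique h0 (hR'.left_mem hR) ▸ h.trans.left_mem hG)
      have h2 : Q.net.post v' y = 0 := Nat.eq_zero_of_not_pos fun h0 =>
        hv.1 (hQ.producer_unique h0 (hR'.right_mem hR) ▸ h.trans.right_mem hG)
      rw [h1, h2]
    · have h1 : 0 < P.net.post t' x := hR'.left_mem hR
      have h2 : 0 < Q.net.post v' y := hR'.right_mem hR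
      have h3 := hP.post_le_one t' x
      have h4 := hQ.post_le_one v' y
      omega

end PartIso

end MappedNet

/-! ### Embedding finite processes into swapped versions of a stuck process. -/

namespace GRProcess

variable {N : PTNet.{u}}

theorem isCausalNet (P : GRProcess N) : P.net.IsCausalNet := (isProcess P).isCausalNet

theorem folds (P : GRProcess N) : P.Folds := (isProcess P).folds

/-- The result of swapping two equally labelled places of the cut of a configuration. -/
noncomputable def swapCut (Q : GRProcess N) {D : Set Q.net.Trans} (hD : Q.net.Config D)
    {p q : Q.net.Place} (hp : p ∈ Q.net.cut D) (hq : q ∈ Q.net.cut D)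
    (hpq : Q.onPlace p = Q.onPlace q) : GRProcess N where
  toMappedNet := Q.swap p q
  isProcess := MappedNet.isProcess_of_isCausalNet (Q.isCausalNet.swapOut hD hp hq)
    (Q.folds.swap hpq)

/-- A swap is an involution: swapping `p` and `q` again restores `Q`, and in the swapped net they
still lie in a common cut. -/
theorem swapCut_swapEquivOne (Q : GRProcess N) {D : Set Q.net.Trans} (hD : Q.net.Config D)
    {p q : Q.net.Place} (hp : p ∈ Q.net.cut D) (hq : q ∈ Q.net.cut D)
    (hpq : Q.onPlace p = Q.onPlace q) : (Q.swapCut hD hp hq hpq).SwapEquivOne Q := by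
  classical
  have hD' := hD.swapOut hp hq subset_rfl
  have hp' := (PTNet.mem_cut_swapOut_iff hp hq subset_rfl).2 hp
  have hq' := (PTNet.mem_cut_swapOut_iff hp hq subset_rfl).2 hq
  have hc := (Q.swapCut hD hp hq hpq).isCausalNet
  refine ⟨p, q, hc.not_causes_of_mem_cut hD' hp' hq', hc.not_causes_of_mem_cut hD' hq' hp', hpq,
    Equiv.refl _, Equiv.refl _, fun _ => rfl, fun s t => ?_, fun _ _ => rfl, fun _ => rfl,
    fun _ => rfl⟩
  refine Eq.symm (Eq.trans (PTNet.swapOut_pre (N := Q.net.swapOut p q) p q s t)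
    (Eq.trans (PTNet.swapOut_pre p q _ t) ?_))
  exact congrArg (Q.net.pre · t) (Equiv.swap_apply_self p q s)

/-- If `Q` can fire, after `D₁`, a transition with the same label as `t`, then it can be swapped
so that the transition fires with the preset corresponding to that of `t`. -/
theorem exists_partIso_insert_aux (P : GRProcess N) {D : Set P.net.Trans} (hD : P.net.Config D)
    {t : P.net.Trans} (ht : P.net.CanAdd D t) (n : ℕ) (Q : GRProcess N) (hs : Q.IsStuck)
    {D' D₁ : Set Q.net.Trans} (hD' : Q.net.Config D') (hD₁ : Q.net.Config D₁) (hsub : D' ⊆ D₁)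
    {R G} (h : MappedNet.PartIso P.toMappedNet Q.toMappedNet D D' R G)
    {v : Q.net.Trans} (hv : Q.net.CanAdd D₁ v) (hl : Q.onTrans v = P.onTrans t)
    (hA : {y | ∃ x ∈ {x | 0 < P.net.pre x t}, R x y} ⊆ Q.net.cut D₁)
    (hn : ({y | ∃ x ∈ {x | 0 < P.net.pre x t}, R x y} \ {y | 0 < Q.net.pre y v}).ncard = n) :
    ∃ Q' : GRProcess N, Q'.SwapEquivStar Q ∧ Q'.IsStuck ∧ ∃ D'' R G, Q'.net.Config D'' ∧
      MappedNet.PartIso P.toMappedNet Q'.toMappedNet (insert t D) D'' R G := by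
  -- The measure `n` counts the places of `A` that `v` does not yet consume; each swap lowers it.
  induction n using Nat.strong_induction_on generalizing Q with
  | _ n ih =>
  set A := {y | ∃ x ∈ {x | 0 < P.net.pre x t}, R x y} with hAdef
  have hApre : Q.IsPresetOf A (P.onTrans t) := fun c =>
    (h.place.encard_image (fun x hx => (ht.2 x hx).1) c).trans (P.folds.encard_pre t c)
  have hvpre : Q.IsPresetOf {y | 0 < Q.net.pre y v} (P.onTrans t) := hl ▸ Q.folds.encard_pre v
  have hfin := hApre.finite_self
  rcases Set.eq_empty_or_nonempty (A \ {y | 0 < Q.net.pre y v}) with h0 | ⟨p, hpA, hpv⟩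
  · have hle : A ⊆ {y | 0 < Q.net.pre y v} := Set.sdiff_eq_empty.1 h0
    -- Both sets have the same finite number of places of each label, so inclusion forces equality.
    have hge : {y | 0 < Q.net.pre y v} ⊆ A := by
      intro y hy
      have := Set.eq_of_subset_of_ncard_le (s := {z | z ∈ A ∧ Q.onPlace z = Q.onPlace y})
        (t := {z | z ∈ {y | 0 < Q.net.pre y v} ∧ Q.onPlace z = Q.onPlace y})
        (fun z hz => ⟨hle hz.1, hz.2⟩) (by rw [hApre.ncard, hvpre.ncard]) (hvpre.finite _)
      exact (this.ge ⟨hy, rfl⟩).1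
    have hv' : Q.net.CanAdd D' v := by
      refine ⟨fun h => hv.1 (hsub h), fun y hy => ?_⟩
      obtain ⟨x, -, hxy⟩ := hge hy
      exact PTNet.mem_cut_of_subset hsub (h.place.right_mem hxy) (hv.2 y hy)
    obtain ⟨R', G', h'⟩ := h.insert P.isCausalNet P.folds Q.isCausalNet Q.folds hD hD' ht hv' hl
      (fun {x y} hxy => by
        have h1 := P.isCausalNet.pre_le_one x t
        have h2 := Q.isCausalNet.pre_le_one y v
        have h3 : 0 < Q.net.pre y v ↔ 0 < P.net.pre x t := by
          constructor
          · intro h3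
            obtain ⟨x', hx', hxy'⟩ := hge h3
            exact h.place.left_unique hxy hxy' ▸ hx'
          · exact fun h3 => hle ⟨x, h3, hxy⟩
        omega)
    exact ⟨Q, .refl, hs, _, R', G', hD'.insert hv', h'⟩
  -- Equal label counts: the surplus place `p` of `A` is balanced by an equally labelled `q` that
  -- `v` consumes outside `A`.
  · obtain ⟨q, hqv, hqA, hpq⟩ : ∃ q, 0 < Q.net.pre q v ∧ q ∉ A ∧ Q.onPlace p = Q.onPlace q := by
      by_contra! hcon
      have hlt := Set.ncard_lt_ncard
        (s := {z | z ∈ {y | 0 < Q.net.pre y v} ∧ Q.onPlace z = Q.onPlace p})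
        (t := {z | z ∈ A ∧ Q.onPlace z = Q.onPlace p})
        ⟨fun z hz => ⟨by_contra fun hzA => hcon z hz.1 hzA hz.2.symm, hz.2⟩,
          fun hsup => hpv (hsup ⟨hpA, rfl⟩).1⟩ (hApre.finite _)
      rw [hApre.ncard, hvpre.ncard] at hlt
      exact hlt.false
    classical
    have hp := hA hpA
    have hq := hv.2 q hqv
    have hlt : (A \ {y | 0 < (Q.net.swapOut p q).pre y v}).ncard <
        (A \ {y | 0 < Q.net.pre y v}).ncard := by
      refine Set.ncard_lt_ncard ⟨?_, fun hsup => ?_⟩ hfin.sdiff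
      · rintro y ⟨hyA, hy⟩
        refine ⟨hyA, fun hy' => hy ?_⟩
        refine lt_of_lt_of_eq hy' ((PTNet.swapOut_pre p q y v).trans ?_).symm
        rw [Equiv.swap_apply_of_ne_of_ne]
        · rintro rfl
          exact hpv hy'
        · rintro rfl
          exact hqA hyA
      · refine (hsup ⟨hpA, hpv⟩).2 (lt_of_lt_of_eq hqv ((PTNet.swapOut_pre p q p v).trans ?_).symm)
        rw [Equiv.swap_apply_left]
    obtain ⟨Q', h1, h2⟩ := ih _ (hn ▸ hlt) (Q.swapCut hD₁ hp hq hpq) (hs.swap hpq)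
      (hD'.swapOut hp hq hsub) (hD₁.swapOut hp hq subset_rfl) hsub (h.swap hsub hp hq)
      ((PTNet.canAdd_swapOut_iff hp.1 hq.1).2 hv) hl
      (fun y hy => (PTNet.mem_cut_swapOut_iff hp hq subset_rfl).2 (hA hy)) rfl
    exact ⟨Q', h1.tail (swapCut_swapEquivOne Q hD₁ hp hq hpq), h2⟩

theorem exists_partIso (hS : N.IsStructuralConflictNet) (hC : N.ConflictFree) (P Q : GRProcess N)
    (hs : Q.IsStuck) {D : Set P.net.Trans} (hD : P.net.Config D) :
    ∃ Q' : GRProcess N, Q'.SwapEquivStar Q ∧ Q'.IsStuck ∧ ∃ D' R G, Q'.net.Config D' ∧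
      MappedNet.PartIso P.toMappedNet Q'.toMappedNet D D' R G := by
  induction hD using PTNet.Config.induct with
  | empty =>
    have he : ∀ K : PTNet.{u}, K.produced ∅ = {s | 0 < K.init s} := fun K => by
      ext s
      simp [PTNet.produced]
    obtain ⟨R, hR⟩ := LabelBij.exists_of_encard_eq (l := P.onPlace) (m := Q.onPlace)
      (s := {x | 0 < P.net.init x}) (t := {y | 0 < Q.net.init y}) P.folds.finite_init
      (fun c => (P.folds.encard_init c).trans (Q.folds.encard_init c).symm)
    refine ⟨Q, .refl, hs, ∅, R, fun _ _ => False, .refl, ?_, ?_, ?_, ?_, ?_⟩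
    · rwa [he, he]
    · constructor <;> simp
    · intro x y hxy
      have h1 : 0 < P.net.init x := hR.left_mem hxy
      have h2 : 0 < Q.net.init y := hR.right_mem hxy
      have h3 := P.isCausalNet.init_le_one (s := x)
      have h4 := Q.isCausalNet.init_le_one (s := y)
      omega
    · exact fun _ h => h.elim
    · exact fun _ h => h.elim
  | insert D t hD ht ih =>
    obtain ⟨Q₁, hQ₁, hs₁, D', R, G, hD', h⟩ := ih
    have hA : {y | ∃ x ∈ {x | 0 < P.net.pre x t}, R x y} ⊆ Q₁.net.cut D' := by
      rintro y ⟨x, hx, hxy⟩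
      refine ⟨h.place.right_mem hxy, fun v hv => ?_⟩
      obtain ⟨w, hw⟩ := h.trans.right_total hv
      rw [h.pre_eq hxy hw]
      exact (ht.2 x hx).2 w (h.trans.left_mem hw)
    obtain ⟨D₁, v, hsub, hD₁, hv, hA₁, hl⟩ := MappedNet.exists_occurrence hS hC Q₁.isCausalNet
      Q₁.folds hs₁ hD' (fun c => (h.place.encard_image (fun x hx => (ht.2 x hx).1) c).trans
        (P.folds.encard_pre t c)) hA
    obtain ⟨Q₂, hQ₂, h₂⟩ := exists_partIso_insert_aux P hD ht _ Q₁ hs₁ hD' hD₁ hsub h hv hl hA₁ rfl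
    exact ⟨Q₂, hQ₂.trans hQ₁, h₂⟩

/-- Every finite process is a prefix of a process obtained by swapping from a given stuck one. -/
theorem exists_isPrefix (hS : N.IsStructuralConflictNet) (hC : N.ConflictFree)
    (P Q : GRProcess N) (hP : P.IsFinite) (hs : Q.IsStuck) :
    ∃ Q' : GRProcess N, Q'.SwapEquivStar Q ∧ P.IsPrefix Q' := by
  have : Finite P.net.Trans := hP
  obtain ⟨D, hD, hD'⟩ := P.isCausalNet.exists_config_superset Set.finite_univ
  -- Since `P` is finite, all its transitions form one configuration, so the partial isomorphism
  -- covers the whole of `P`.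
  obtain rfl := Set.univ_subset_iff.1 hD'
  obtain ⟨Q', hQ', -, D', R, G, -, h⟩ := exists_partIso hS hC P Q hs hD
  have hp := h.place
  rw [P.isCausalNet.produced_univ] at hp
  choose f hf using fun x => hp.left_total (Set.mem_univ x)
  choose g hg using fun t => h.trans.left_total (Set.mem_univ t)
  refine ⟨Q', hQ', ⟨f, g, fun x y hxy => hp.left_unique (hf x) (hxy ▸ hf y),
    fun x y hxy => h.trans.left_unique (hg x) (hxy ▸ hg y), fun s => h.init_eq (hf s), ?_,
    fun s t => h.pre_eq (hf s) (hg t), fun t s => h.post_eq (hf s) (hg t),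
    fun s => hp.label (hf s), fun t => h.trans.label (hg t)⟩⟩
  intro y hy
  by_contra h0
  obtain ⟨x, hx⟩ := hp.right_total (Or.inl (Nat.pos_of_ne_zero h0))
  exact hy ⟨x, hp.right_unique (hf x) hx⟩

theorem swapEquiv_of_isStuck (hS : N.IsStructuralConflictNet) (hC : N.ConflictFree)
    (P Q : GRProcess N) (hP : P.IsStuck) (hQ : Q.IsStuck) : P.SwapEquiv Q := by
  have hiso : ∀ P : GRProcess N, P.Iso P := fun P =>
    ⟨.refl _, .refl _, fun _ => rfl, fun _ _ => rfl, fun _ _ => rfl, fun _ => rfl, fun _ => rfl⟩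
  constructor
  · intro P' hP' _
    obtain ⟨Q', h1, h2⟩ := exists_isPrefix hS hC P' Q hP' hQ
    exact ⟨Q', P', h1, h2, hiso P'⟩
  · intro Q' hQ' _
    obtain ⟨P', h1, h2⟩ := exists_isPrefix hS hC Q' P hQ' hP
    exact ⟨P', Q', h1, h2, hiso Q'⟩

end GRProcess

/-! ### Maximal processes -/

theorem encard_range_fin {α : Type*} {n : ℕ} {f : Fin n → α} (hf : Function.Injective f) :
    (Set.range f).encard = n := by
  rw [← Set.image_univ, hf.encard_image, Set.encard_univ, ENat.card_eq_coe_fintype_card,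
    Fintype.card_fin]

namespace MappedNet

variable {N : PTNet.{u}} {P : MappedNet N} {A : Set P.net.Place} {a : N.Trans}

theorem IsPresetOf.nonempty (h : P.IsPresetOf A a) : A.Nonempty := by
  obtain ⟨c, hc⟩ := N.pre_nonempty a
  have hc : 0 < N.pre c a := hc
  rw [← h.ncard, Set.ncard_pos (h.finite c)] at hc
  exact hc.mono fun s hs => hs.1

open Classical in
/-- The extension of `P` by one transition labelled `a` with preset `A`. -/
noncomputable def addTrans (P : MappedNet N) {A : Set P.net.Place} {a : N.Trans}
    (hA : P.IsPresetOf A a) : MappedNet N where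
  net :=
    { Place := P.net.Place ⊕ (Σ s : N.Place, Fin (N.post a s))
      Trans := Option P.net.Trans
      pre := fun x t => x.elim (fun s => t.elim (if s ∈ A then 1 else 0) (P.net.pre s)) fun _ => 0
      post := fun t x => t.elim (x.elim (fun _ => 0) fun _ => 1)
        fun t => x.elim (P.net.post t) fun _ => 0
      init := fun x => x.elim P.net.init fun _ => 0
      pre_finite := by
        rintro (_ | t)
        · refine (hA.finite_self.image Sum.inl).subset ?_
          rintro (s | z) hs
          · refine ⟨s, by_contra fun h => ?_, rfl⟩
            simp [h] at hs
          · exact absurd hs (lt_irrefl 0)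
        · refine ((P.net.pre_finite t).image Sum.inl).subset ?_
          rintro (s | z) hs
          · exact ⟨s, hs, rfl⟩
          · exact absurd hs (lt_irrefl 0)
      pre_nonempty := by
        rintro (_ | t)
        · obtain ⟨s, hs⟩ := hA.nonempty
          exact ⟨.inl s, by simp [hs]⟩
        · obtain ⟨s, hs⟩ := P.net.pre_nonempty t
          exact ⟨.inl s, hs⟩
      post_finite := by
        rintro (_ | t)
        · refine ((N.post_finite a).biUnion fun c _ =>
            Set.finite_range fun i : Fin (N.post a c) =>
              (Sum.inr ⟨c, i⟩ : P.net.Place ⊕ (Σ s : N.Place, Fin (N.post a s)))).subset ?_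
          rintro (s | ⟨c, i⟩) hs
          · exact absurd hs (lt_irrefl 0)
          · exact Set.mem_biUnion (x := c) i.pos ⟨i, rfl⟩
        · refine ((P.net.post_finite t).image Sum.inl).subset ?_
          rintro (s | z) hs
          · exact ⟨s, hs, rfl⟩
          · exact absurd hs (lt_irrefl 0) }
  onPlace := Sum.elim P.onPlace Sigma.fst
  onTrans := fun t => t.elim a P.onTrans

theorem addTrans_isCausalNet (hP : P.net.IsCausalNet) (hA : P.IsPresetOf A a)
    (hA' : ∀ s ∈ A, ∀ t, P.net.pre s t = 0) : (P.addTrans hA).net.IsCausalNet where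
  pre_le_one := by
    rintro (s | z) (_ | t)
    · simp only [addTrans, Sum.elim_inl, Option.elim_none]
      split_ifs <;> simp
    · exact hP.pre_le_one s t
    · exact Nat.zero_le _
    · exact Nat.zero_le _
  post_le_one := by
    rintro (_ | t) (s | z)
    · exact Nat.zero_le _
    · exact le_rfl
    · exact hP.post_le_one t s
    · exact Nat.zero_le _
  consumer_unique := by
    have key : ∀ {s t}, 0 < (P.addTrans hA).net.pre (.inl s) none → ¬ 0 < P.net.pre s t := by
      intro s t h h'
      refine h'.ne' (hA' s (by_contra fun hs => ?_) t)
      simp [addTrans, hs] at h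
    rintro (s | z) (_ | t) (_ | v) h h'
    · rfl
    · exact (key h h').elim
    · exact (key h' h).elim
    · exact congrArg some (hP.consumer_unique h h')
    all_goals exact absurd h (lt_irrefl 0)
  producer_unique := by
    rintro (s | z) (_ | t) (_ | v) h h'
    · rfl
    · exact absurd h (lt_irrefl 0)
    · exact absurd h' (lt_irrefl 0)
    · exact congrArg some (hP.producer_unique h h')
    · rfl
    · exact absurd h' (lt_irrefl 0)
    · exact absurd h (lt_irrefl 0)
    · exact absurd h (lt_irrefl 0)
  init_eq := by
    classical
    rintro (s | z)
    · refine (hP.init_eq s).trans (if_congr ⟨fun h => ?_, fun h t => h (some t)⟩ rfl rfl)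
      rintro (_ | t)
      · rfl
      · exact h t
    · exact (if_neg fun h => one_ne_zero (h none)).symm
  wf := by
    -- The postplaces of the new transition have no consumer, so it precedes nothing.
    have key : ∀ t, Acc (P.addTrans hA).net.Prec (some t) := by
      intro t
      induction t using hP.wf.induction with
      | _ t ih =>
        refine ⟨_, ?_⟩
        rintro (_ | v) ⟨s | z, h, h'⟩
        · exact absurd h (lt_irrefl 0)
        · exact absurd h' (lt_irrefl 0)
        · exact ih v ⟨s, h, h'⟩
        · exact absurd h' (lt_irrefl 0)
    refine ⟨?_⟩
    rintro (_ | t)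
    · refine ⟨_, ?_⟩
      rintro (_ | v) ⟨s | z, h, h'⟩
      · exact absurd h (lt_irrefl 0)
      · exact absurd h' (lt_irrefl 0)
      · exact key v
      · exact key v
    · exact key t

theorem addTrans_folds (hP : P.Folds) (hA : P.IsPresetOf A a) : (P.addTrans hA).Folds := by
  classical
  -- Label counts are unchanged for sets consisting of old places only; this covers everything but
  -- the new postset.
  have hl : ∀ (U : Set (P.addTrans hA).net.Place) (V : Set P.net.Place) (c : N.Place),
      (∀ s, Sum.inl s ∈ U ↔ s ∈ V) → (∀ z, Sum.inr z ∉ U) →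
      {x | x ∈ U ∧ (P.addTrans hA).onPlace x = c}.encard =
        {s | s ∈ V ∧ P.onPlace s = c}.encard := by
    intro U V c h h'
    refine Eq.trans (congrArg Set.encard ?_) (Function.Injective.encard_image
      (f := (Sum.inl : _ → P.net.Place ⊕ (Σ s : N.Place, Fin (N.post a s)))) Sum.inl_injective _)
    ext (s | z)
    · constructor
      · exact fun hs => ⟨s, ⟨(h s).1 hs.1, hs.2⟩, rfl⟩
      · rintro ⟨s', hs, hs'⟩
        obtain rfl := Sum.inl_injective hs'
        exact ⟨(h _).2 hs.1, hs.2⟩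
    · constructor
      · exact fun hs => (h' z hs.1).elim
      · rintro ⟨s', hs, hs'⟩
        exact (Sum.inl_ne_inr hs').elim
  refine ⟨fun c => ?_, ?_, ?_⟩
  · exact (hl {x | 0 < (P.addTrans hA).net.init x} _ c (fun _ => Iff.rfl)
      fun _ => lt_irrefl 0).trans (hP.encard_init c)
  · rintro (_ | t) c
    · refine (hl _ A c (fun s => ?_) fun _ => lt_irrefl 0).trans (hA c)
      change 0 < ite _ _ _ ↔ _
      split_ifs with hs <;> simp [hs]
    · exact (hl _ _ c (fun _ => Iff.rfl) fun _ => lt_irrefl 0).trans (hP.encard_pre t c)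
  · rintro (_ | t) c
    · refine Eq.trans (congrArg Set.encard ?_)
        (encard_range_fin (f := fun i : Fin (N.post a c) => (Sum.inr ⟨c, i⟩ :
          P.net.Place ⊕ (Σ s : N.Place, Fin (N.post a s)))) fun i j hij => by simpa using hij)
      ext (s | ⟨c', i⟩)
      · constructor
        · exact fun h => absurd h.1 (lt_irrefl 0)
        · rintro ⟨j, hj⟩
          exact (Sum.inr_ne_inl hj).elim
      · constructor
        · rintro ⟨-, rfl⟩
          exact ⟨i, rfl⟩
        · rintro ⟨j, hj⟩
          exact ⟨one_pos, (congrArg Sigma.fst (Sum.inr_injective hj)).symm⟩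
    · exact (hl {x | 0 < (P.addTrans hA).net.post (some t) x} _ c (fun _ => Iff.rfl)
        fun _ => lt_irrefl 0).trans (hP.encard_post t c)

/-- The process `P` as a prefix of its extension by one transition. -/
def addTransEmb (hA : P.IsPresetOf A a) : P.PrefixEmb (P.addTrans hA) where
  f := Sum.inl
  g := some
  f_inj := Sum.inl_injective
  g_inj := Option.some_injective _
  init_eq _ := rfl
  init_range := by
    rintro (s | z) h
    · exact (h ⟨s, rfl⟩).elim
    · rfl
  pre_eq _ _ := rfl
  post_eq _ _ := rfl
  onPlace_eq _ := rfl
  onTrans_eq _ := rfl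

end MappedNet

namespace GRProcess

variable {N : PTNet.{u}} {P : GRProcess N}

theorem IsMaximal.isStuck (h : P.IsMaximal) : P.IsStuck := by
  intro a A hA
  by_contra! hcon
  obtain ⟨t, ht⟩ := (h ⟨P.addTrans hA, MappedNet.isProcess_of_isCausalNet
    (MappedNet.addTrans_isCausalNet P.isCausalNet hA fun s hs t => Nat.le_zero.1 (hcon s hs t))
    (MappedNet.addTrans_folds P.folds hA)⟩ (MappedNet.addTransEmb hA)).2 none
  exact Option.some_ne_none t ht

theorem isMaximal_of_isStuck (h : P.IsStuck) : P.IsMaximal := by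
  -- Postsets of old transitions already have their full label count in `P`, and no initial place is
  -- new; so a new place needs a new producer. An earliest new transition `v` would then have all
  -- its preplaces in `P`; by stuckness an old transition consumes one of them, and uniqueness of
  -- consumers identifies it with `v`.
  intro Q e
  have hpost : ∀ t s, 0 < Q.net.post (e.g t) s → s ∈ Set.range e.f := by
    intro t s hs
    have hsub : e.f '' {x | 0 < P.net.post t x ∧ P.onPlace x = Q.onPlace s} ⊆
        {y | 0 < Q.net.post (e.g t) y ∧ Q.onPlace y = Q.onPlace s} := by
      rintro _ ⟨x, ⟨h1, h2⟩, rfl⟩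
      exact ⟨(e.post_eq t x).symm ▸ h1, (e.onPlace_eq x).trans h2⟩
    have heq := Set.eq_of_subset_of_ncard_le hsub (by
      rw [Set.ncard_image_of_injective _ e.f_inj, P.folds.ncard_post, Q.folds.ncard_post,
        e.onTrans_eq]) (Q.folds.finite_post _ _)
    obtain ⟨x, -, hx⟩ := heq.ge ⟨hs, rfl⟩
    exact ⟨x, hx⟩
  have hplace : ∀ s, (∀ v, 0 < Q.net.post v s → v ∈ Set.range e.g) → s ∈ Set.range e.f := by
    intro s hv
    by_contra hs
    obtain ⟨v, hvs⟩ := Q.isCausalNet.init_eq_zero_iff.1 (e.init_range s hs)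
    obtain ⟨t, rfl⟩ := hv v hvs
    exact hs (hpost t s hvs)
  have hg : Function.Surjective e.g := by
    intro v
    induction v using Q.isCausalNet.wf.induction with
    | _ v ih =>
      have hpre : ∀ s, 0 < Q.net.pre s v → s ∈ Set.range e.f := fun s hs =>
        hplace s fun w hw => ih w ⟨s, hw, hs⟩
      obtain ⟨s, hs, t, ht⟩ := h (Q.onTrans v) {x | 0 < Q.net.pre (e.f x) v} fun c => by
        rw [← Q.folds.encard_pre v c, ← e.f_inj.encard_image]
        congr 1
        ext y
        constructor
        · rintro ⟨x, ⟨h1, h2⟩, rfl⟩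
          exact ⟨h1, (e.onPlace_eq x).trans h2⟩
        · rintro ⟨h1, h2⟩
          obtain ⟨x, rfl⟩ := hpre y h1
          exact ⟨x, ⟨h1, (e.onPlace_eq x).symm.trans h2⟩, rfl⟩
      rw [← e.pre_eq] at ht
      exact ⟨t, Q.isCausalNet.consumer_unique ht hs⟩
  exact ⟨fun s => hplace s fun v _ => hg v, hg⟩

end GRProcess

/-! ### Existence of maximal processes -/

namespace PTNet

variable (N : PTNet.{u})

/-- The tokens of the unfolding of `N`: the `i`-th initial token on `s`, and the `i`-th token put
on `s` by a firing of `t` that consumes the tokens in the list `l`. -/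
inductive Token : Type u
  | init (s : N.Place) (i : ℕ) : Token
  | out (t : N.Trans) (l : List Token) (s : N.Place) (i : ℕ) : Token

variable {N}

/-- The place on which a token lies. -/
def Token.place : N.Token → N.Place
  | .init s _ => s
  | .out _ _ s _ => s

/-- The firing that has produced a token, if any. -/
def Token.producer : N.Token → Option (N.Trans × List N.Token)
  | .init _ _ => none
  | .out t l _ _ => some (t, l)

/-- The tokens that occur when the firings in `C` have taken place. -/
def tokens (C : Set (N.Trans × List N.Token)) : Set N.Token := {x |
  match x with
  | .init s i => i < N.init s
  | .out t l s i => (t, l) ∈ C ∧ i < N.post t s}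

/-- The firings in `C` are causally closed and do not compete for tokens. -/
structure IsUnfolding (C : Set (N.Trans × List N.Token)) : Prop where
  mem_tokens : ∀ e ∈ C, ∀ x ∈ e.2, x ∈ tokens C
  encard_pre : ∀ e ∈ C, ∀ c, {x | x ∈ e.2 ∧ x.place = c}.encard = N.pre c e.1
  unique : ∀ e ∈ C, ∀ e' ∈ C, ∀ x, x ∈ e.2 → x ∈ e'.2 → e = e'

variable {C C' : Set (N.Trans × List N.Token)}

theorem tokens_mono (h : C ⊆ C') : tokens C ⊆ tokens C' := by
  rintro (⟨s, i⟩ | ⟨t, l, s, i⟩) hx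
  · exact hx
  · exact ⟨h hx.1, hx.2⟩

theorem mem_of_producer_eq {x : N.Token} {e : N.Trans × List N.Token} (hx : x ∈ tokens C)
    (h : x.producer = some e) : e ∈ C := by
  obtain ⟨s, i⟩ | ⟨t, l, s, i⟩ := x
  · exact (Option.some_ne_none _ h.symm).elim
  · exact Option.some_injective _ h ▸ hx.1

theorem encard_init_tokens (c : N.Place) :
    {x : tokens C | x.1.producer = none ∧ x.1.place = c}.encard = N.init c := by
  rw [← Subtype.val_injective.encard_image]
  refine Eq.trans (congrArg Set.encard ?_)
    (encard_range_fin (f := fun i : Fin (N.init c) => Token.init c i) fun i j hij => by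
      simpa [Fin.ext_iff] using hij)
  ext x
  constructor
  · rintro ⟨⟨⟨s, i⟩ | ⟨t, l, s, i⟩, hx⟩, ⟨h, rfl⟩, rfl⟩
    · exact ⟨⟨i, hx⟩, rfl⟩
    · exact (Option.some_ne_none _ h).elim
  · rintro ⟨i, rfl⟩
    exact ⟨⟨_, i.2⟩, ⟨rfl, rfl⟩, rfl⟩

theorem encard_post_tokens {e : N.Trans × List N.Token} (he : e ∈ C) (c : N.Place) :
    {x : tokens C | x.1.producer = some e ∧ x.1.place = c}.encard = N.post e.1 c := by
  rw [← Subtype.val_injective.encard_image]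
  refine Eq.trans (congrArg Set.encard ?_)
    (encard_range_fin (f := fun i : Fin (N.post e.1 c) => Token.out e.1 e.2 c i) fun i j hij => by
      simpa [Fin.ext_iff] using hij)
  ext x
  constructor
  · rintro ⟨⟨⟨s, i⟩ | ⟨t, l, s, i⟩, hx⟩, ⟨h, rfl⟩, rfl⟩
    · exact (Option.some_ne_none _ h.symm).elim
    · obtain rfl := Option.some_injective _ h
      exact ⟨⟨i, hx.2⟩, rfl⟩
  · rintro ⟨i, rfl⟩
    exact ⟨⟨_, (⟨he, i.2⟩ : e ∈ C ∧ _)⟩, ⟨rfl, rfl⟩, rfl⟩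

open Classical in
/-- The part of the unfolding of `N` consisting of the firings in `C`. -/
noncomputable def IsUnfolding.mappedNet (hC : N.IsUnfolding C) : MappedNet N where
  net :=
    { Place := tokens C
      Trans := C
      pre := fun x e => if x.1 ∈ e.1.2 then 1 else 0
      post := fun e x => if x.1.producer = some e.1 then 1 else 0
      init := fun x => if x.1.producer = none then 1 else 0
      pre_finite := fun e => by
        refine Set.Finite.of_injOn (f := Subtype.val) (t := {x | x ∈ e.1.2}) ?_
          Subtype.val_injective.injOn (List.finite_toSet _)
        intro x hx
        by_contra h
        simp [show x.1 ∉ e.1.2 from h] at hx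
      pre_nonempty := fun e => by
        obtain ⟨c, hc⟩ := N.pre_nonempty e.1.1
        have h := hC.encard_pre e.1 e.2 c
        have hne : {x | x ∈ e.1.2 ∧ x.place = c}.encard ≠ 0 := by
          rw [h]
          exact_mod_cast hc.ne'
        obtain ⟨x, hx, -⟩ := Set.encard_ne_zero.1 hne
        exact ⟨⟨x, hC.mem_tokens e.1 e.2 x hx⟩, by simp [hx]⟩
      post_finite := fun e => by
        refine ((N.post_finite e.1.1).biUnion (t := fun c =>
          {x : tokens C | x.1.producer = some e.1 ∧ x.1.place = c}) fun c _ => ?_).subset ?_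
        · rw [← Set.encard_lt_top_iff, encard_post_tokens e.2]
          exact ENat.natCast_lt_top _
        · intro x hx
          have hx : x.1.producer = some e.1 := by
            by_contra h
            simp [h] at hx
          refine Set.mem_biUnion (x := x.1.place) ?_ ⟨hx, rfl⟩
          obtain ⟨⟨s, i⟩ | ⟨t, l, s, i⟩, hx'⟩ := x
          · exact (Option.some_ne_none _ hx.symm).elim
          · rw [← Option.some_injective _ hx]
            exact (Nat.zero_le i).trans_lt hx'.2 }
  onPlace := fun x => x.1.place
  onTrans := fun e => e.1.1

namespace IsUnfolding

variable (hC : N.IsUnfolding C)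

theorem pre_pos_iff {x : tokens C} {e : C} : 0 < hC.mappedNet.net.pre x e ↔ x.1 ∈ e.1.2 := by
  simp only [mappedNet]
  split_ifs with h <;> simp [h]

theorem post_pos_iff {x : tokens C} {e : C} :
    0 < hC.mappedNet.net.post e x ↔ x.1.producer = some e.1 := by
  simp only [mappedNet]
  split_ifs with h <;> simp [h]

theorem init_pos_iff {x : tokens C} : 0 < hC.mappedNet.net.init x ↔ x.1.producer = none := by
  simp only [mappedNet]
  split_ifs with h <;> simp [h]

theorem isCausalNet : hC.mappedNet.net.IsCausalNet where
  pre_le_one x e := by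
    simp only [mappedNet]
    split_ifs <;> simp
  post_le_one e x := by
    simp only [mappedNet]
    split_ifs <;> simp
  consumer_unique {x e e'} h h' :=
    Subtype.ext (hC.unique _ e.2 _ e'.2 _ (hC.pre_pos_iff.1 h) (hC.pre_pos_iff.1 h'))
  producer_unique {x e e'} h h' := Subtype.ext <| Option.some_injective _ <|
    (hC.post_pos_iff.1 h).symm.trans (hC.post_pos_iff.1 h')
  init_eq x := by
    classical
    refine if_congr ⟨fun h e => if_neg fun h' => ?_, fun h => ?_⟩ rfl rfl
    · exact Option.some_ne_none _ (h'.symm.trans h)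
    · by_contra hne
      obtain ⟨e, he⟩ := Option.ne_none_iff_exists'.1 hne
      exact (hC.post_pos_iff.2 he).ne' (h ⟨e, mem_of_producer_eq x.2 he⟩)
  wf := by
    -- A consumed token contains the input list of its producer as a subterm, so list size strictly
    -- increases along causality.
    refine Subrelation.wf (r := InvImage (· < ·) fun e => sizeOf e.1.2) ?_
      (InvImage.wf _ wellFounded_lt)
    rintro e e' ⟨x, h, h'⟩
    replace h := hC.post_pos_iff.1 h
    replace h' := List.sizeOf_lt_of_mem (hC.pre_pos_iff.1 h')
    obtain ⟨⟨s, i⟩ | ⟨t, l, s, i⟩, hx⟩ := x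
    · exact (Option.some_ne_none _ h.symm).elim
    · have h2 : l = e.1.2 := congrArg Prod.snd (Option.some_injective _ h)
      simp only [Token.out.sizeOf_spec] at h'
      change sizeOf e.1.2 < sizeOf e'.1.2
      rw [← h2]
      omega

theorem folds : hC.mappedNet.Folds where
  encard_init c := by
    rw [← encard_init_tokens (C := C) c]
    exact congrArg Set.encard (Set.ext fun x => and_congr hC.init_pos_iff Iff.rfl)
  encard_pre e c := by
    refine Eq.trans ((Function.Injective.encard_image (f := (Subtype.val : tokens C → _))
      Subtype.val_injective _).symm.trans (congrArg Set.encard ?_)) (hC.encard_pre e.1 e.2 c)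
    ext x
    constructor
    · rintro ⟨x, ⟨h1, h2⟩, rfl⟩
      exact ⟨hC.pre_pos_iff.1 h1, h2⟩
    · rintro ⟨h1, h2⟩
      exact ⟨⟨x, hC.mem_tokens _ e.2 x h1⟩, ⟨hC.pre_pos_iff.2 h1, h2⟩, rfl⟩
  encard_post e c := by
    refine Eq.trans ?_ (encard_post_tokens e.2 c)
    exact congrArg Set.encard (Set.ext fun x => and_congr hC.post_pos_iff Iff.rfl)

/-- An unconsumed set `A` with the labels of a preset would yield a firing `e` that can be added to
`C`. By maximality `e` is already in `C`, so it consumes `A`, which is nonempty: a contradiction. -/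
theorem isStuck (hmax : ∀ C', N.IsUnfolding C' → C ⊆ C' → C' ⊆ C) : hC.mappedNet.IsStuck := by
  intro a A hA
  by_contra! hcon
  let A' : Set N.Token := Subtype.val '' (A : Set (tokens C))
  have hfin : A'.Finite := Set.Finite.image _ hA.finite_self
  -- The order of the list is arbitrary; only its set of members matters.
  set e : N.Trans × List N.Token := (a, hfin.toFinset.toList)
  have hmem : ∀ x, x ∈ e.2 ↔ x ∈ A' := fun x => by simp [e]
  have hfree : ∀ e' ∈ C, ∀ x, x ∈ e.2 → x ∉ e'.2 := by
    intro e' he' x hx hx'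
    obtain ⟨y, hy, rfl⟩ := (hmem x).1 hx
    exact (hcon y hy ⟨e', he'⟩).not_gt (hC.pre_pos_iff.2 hx')
  have he : e ∈ C := by
    refine hmax (insert e C) ⟨?_, ?_, ?_⟩ (Set.subset_insert _ _) (Set.mem_insert _ _)
    · rintro e' (rfl | he') x hx
      · obtain ⟨y, hy, rfl⟩ := (hmem x).1 hx
        exact tokens_mono (Set.subset_insert _ _) y.2
      · exact tokens_mono (Set.subset_insert _ _) (hC.mem_tokens _ he' x hx)
    · rintro e' (rfl | he') c
      · refine Eq.trans (congrArg Set.encard ?_) ((Function.Injective.encard_image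
          (f := (Subtype.val : tokens C → _)) Subtype.val_injective _).trans (hA c))
        ext x
        constructor
        · rintro ⟨h1, h2⟩
          obtain ⟨y, hy, rfl⟩ := (hmem x).1 h1
          exact ⟨y, ⟨hy, h2⟩, rfl⟩
        · rintro ⟨y, ⟨hy, h2⟩, rfl⟩
          exact ⟨(hmem _).2 ⟨y, hy, rfl⟩, h2⟩
      · exact hC.encard_pre e' he' c
    · rintro e₁ (rfl | h₁) e₂ (rfl | h₂) x hx hx'
      · rfl
      · exact (hfree _ h₂ x hx hx').elim
      · exact (hfree _ h₁ x hx' hx).elim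
      · exact hC.unique _ h₁ _ h₂ x hx hx'
  obtain ⟨y, hy⟩ := hA.nonempty
  have hye : y.1 ∈ e.2 := (hmem _).2 ⟨y, hy, rfl⟩
  exact hfree e he _ hye hye

end IsUnfolding

/-- Each condition involves at most two firings, and in a chain these lie in a common member. -/
theorem isUnfolding_sUnion {S : Set (Set (N.Trans × List N.Token))}
    (hS : ∀ C ∈ S, N.IsUnfolding C) (hc : IsChain (· ⊆ ·) S) : N.IsUnfolding (⋃₀ S) where
  mem_tokens := by
    rintro e ⟨C, hC, he⟩ x hx
    exact tokens_mono (Set.subset_sUnion_of_mem hC) ((hS C hC).mem_tokens e he x hx)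
  encard_pre := by
    rintro e ⟨C, hC, he⟩
    exact (hS C hC).encard_pre e he
  unique := by
    rintro e ⟨C, hC, he⟩ e' ⟨C', hC', he'⟩
    obtain h | h := hc.total hC hC'
    · exact (hS C' hC').unique e (h he) e' he'
    · exact (hS C hC).unique e he e' (h he')

variable (N) in
theorem exists_isMaximal : ∃ P : GRProcess N, P.IsMaximal := by
  obtain ⟨C, hC⟩ := zorn_subset {C | N.IsUnfolding C} fun S hS hc =>
    ⟨⋃₀ S, isUnfolding_sUnion hS hc, fun C hC => Set.subset_sUnion_of_mem hC⟩
  have hC' : N.IsUnfolding C := hC.prop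
  exact ⟨⟨hC'.mappedNet, MappedNet.isProcess_of_isCausalNet hC'.isCausalNet hC'.folds⟩,
    GRProcess.isMaximal_of_isStuck (hC'.isStuck fun C' h h' => hC.le_of_ge h h')⟩

end PTNet

theorem mainTheorem3 (N : PTNet.{u}) (hS : N.IsStructuralConflictNet) (hC : N.ConflictFree) :
    (∃ P : GRProcess N, P.IsMaximal) ∧
      ∀ P Q : GRProcess N, P.IsMaximal → Q.IsMaximal → P.SwapEquiv Q :=
  ⟨N.exists_isMaximal, fun P Q hP hQ =>
    GRProcess.swapEquiv_of_isStuck hS hC P Q hP.isStuck hQ.isStuck⟩
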